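/- **Definitions.** A lattice is *l.f.f.c.* if all its intervals are finite and every element has finitely many upper and finitely many lower covers. A *tolerance* on a lattice is a reflexive, symmetric relation compatible with $\vee$ and $\wedge$. A *modular connected system* (m.c. system) $\mathcal C$ consists of a skeleton lattice $S$, a tolerance $\gamma$ on $S$, lattices (blocks) $L_x$ ($x\in S$), and, for all $x\le y$ in $S$ with $x\mathrel\gamma y$, a lattice isomorphism $\phi_x^y$ from a (nonempty) filter $F_x^y$ of $L_x$ onto a (nonempty) ideal $I_x^y$ of $L_y$, such that 1. $S$ is l.f.f.c., and each $L_x$ is finite, modular and complemented; 2. $F_x^x=I_x^x=L_x$ and $\phi_x^x=\mathrm{id}$; 3. if $x\le y\le z$, $x\mathrel\gamma y$, $y\mathrel\gamma z$ and $I_x^y\cap F_y^z\ne\emptyset$, then $x\mathrel\gamma z$; 4. if $x\le z\le y$ and $x\mathrel\gamma y$, then $F_x^y=(\phi_x^z)^{-1}(I_x^z\cap F_z^y)$, $I_x^y=\phi_z^y(I_x^z\cap F_z^y)$ and $\phi_x^y=\phi_z^y\circ\phi_x^z|_{F_x^y}$; 5. if $x\mathrel\gamma y$, then $I_x^{x\vee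 y}\cap I_y^{x\vee y}\subseteq I_{x\wedge y}^{x\vee y}$ and $F_{x\wedge y}^{x}\cap F_{x\wedge y}^{y}\subseteq F_{x\wedge y}^{x\vee y}$; 6. if $y$ covers $x$ in $S$, then $x\mathrel\gamma y$, $F_x^y\ne L_x$ and $I_x^y\ne L_y$. An *isomorphism* from $\mathcal C$ to an m.c. system $\mathcal C'$ consists of a lattice isomorphism $\chi_S:S\to S'$ and lattice isomorphisms $\chi_{B,x}:L_x\to L'_{\chi_S(x)}$ such that $x\mathrel\gamma y\iff\chi_S(x)\mathrel{\gamma'}\chi_S(y)$, and for $x\le y$ with $x\mathrel\gamma y$ the maps $\chi_{B,x}$, $\chi_{B,y}$ carry $F_x^y$, $I_x^y$ onto the corresponding sets of $\mathcal C'$ and satisfy $\chi_{B,y}\circ\phi_x^y=\phi'^{\,\chi_S(y)}_{\chi_S(x)}\circ\chi_{B,x}|_{F_x^y}$. The *sum* $L$ of $\mathcal C$ is the set of pairs $(x,a)$, $x\in S$, $a\in L_x$, modulo the relation $(x,a)\sim(y,b)$ iff $x\mathrel\gamma y$, $a\in F_x^{x\vee y}$, $b\in F_y^{x\vee y}$ and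 $\phi_x^{x\vee y}(a)=\phi_y^{x\vee y}(b)$; let $\pi_x:L_x\to L$ be the canonical map, and put $\Lambda_x=\pi_x(L_x)$, $0_x=\pi_x(\hat 0_{L_x})$, $1_x=\pi_x(\hat 1_{L_x})$. For $p,q\in L$ write $p\le_x q$ if $p=\pi_x(a)$ and $q=\pi_x(b)$ for some $a\le b$ in $L_x$, and put $p\le q$ if there are $x_1\le\dots\le x_n$ in $S$ and $a_0,\dots,a_n\in L$ with $p=a_0\le_{x_1}a_1\le_{x_2}\dots\le_{x_n}a_n=q$. The *dissection* of a modular l.f.f.c. lattice $P$ has as its skeleton the set of blocks of $P$, i.e. of the intervals of $P$ that are maximal under inclusion among the complemented ones, ordered by their minimum elements; the block indexed by $B$ is $B$ itself; $B\mathrel\gamma B'$ iff $B\cap B'\neq\emptyset$; and for $B\le B'$ with $B\cap B'\ne\emptyset$, $F_B^{B'}=I_B^{B'}=B\cap B'$ and $\phi_B^{B'}$ is the identity. **Theorem.** Let $\mathcal C$ be an m.c. system and $L$ its sum. Then $\sim$ is an equivalence relation, $L$ is a modular l.f.f.c. lattice under $\le$, the blocks of $L$ ordered by their minimum elements form a lattice,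 and the dissection of $L$ is an m.c. system. For each $x\in S$, $\Lambda_x=[0_x,1_x]$ is a block of $L$, and $\chi_S:x\mapsto\Lambda_x$ together with $\chi_{B,x}:L_x\to\Lambda_x$, $a\mapsto\pi_x(a)$, is an isomorphism of m.c. systems from $\mathcal C$ to the dissection of $L$. -/

import Mathlib

universe u v u' v'

namespace ModularGluing

/-- A partially ordered set is locally finite with finite covers: all intervals are finite, and every
element has finitely many upper covers and finitely many lower covers. -/
structure IsLFFC (P : Type*) [PartialOrder P] : Prop where
  finite_Icc : ∀ a b : P, (Set.Icc a b).Finite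
  finite_upper : ∀ a : P, {b : P | a ⋖ b}.Finite
  finite_lower : ∀ a : P, {b : P | b ⋖ a}.Finite

/-- A tolerance on a lattice: a reflexive and symmetric relation compatible with join and meet. -/
structure IsTolerance {S : Type*} [Lattice S] (r : S → S → Prop) : Prop where
  refl : ∀ a, r a a
  symm : ∀ a b, r a b → r b a
  sup : ∀ a b c d, r a b → r c d → r (a ⊔ c) (b ⊔ d)
  inf : ∀ a b c d, r a b → r c d → r (a ⊓ c) (b ⊓ d)

/-- The data that ties the blocks `L x`, indexed by the skeleton `S`, together: the overlap
tolerance `γ`, and for `x ≤ y` with `γ x y` the connection `φ x y` from `F x y ⊆ L x` to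
`I x y ⊆ L y`. The values of `F`, `I`, `φ` at all other pairs `(x, y)` are irrelevant: nothing below
looks at them. -/
structure Connections (S : Type u) (L : S → Type v) where
  γ : S → S → Prop
  F : ∀ x _y : S, Set (L x)
  I : ∀ _x y : S, Set (L y)
  φ : ∀ x y : S, F x y → I x y

namespace Connections

section

variable {S : Type u} [Lattice S] {L : S → Type v} [∀ x, Lattice (L x)] [∀ x, BoundedOrder (L x)]

/-- The axioms of a modular connected system with skeleton `S`, overlap tolerance `γ`, blocks
`L x` and connections `φ x y : F x y → I x y` for `x ≤ y`, `γ x y`. Filters and ideals are lattice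
filters and ideals; they are nonempty. -/
structure IsMCSystem (C : Connections S L) : Prop where
  tolerance : IsTolerance C.γ
  skeleton_lffc : IsLFFC S
  block_finite : ∀ x, Finite (L x)
  block_modular : ∀ x, IsModularLattice (L x)
  block_complemented : ∀ x, ComplementedLattice (L x)
  filter : ∀ x y, x ≤ y → C.γ x y → Order.IsPFilter (C.F x y)
  ideal : ∀ x y, x ≤ y → C.γ x y → Order.IsIdeal (C.I x y)
  iso : ∀ x y, x ≤ y → C.γ x y → ∃ e : C.F x y ≃o C.I x y, ∀ a, e a = C.φ x y a
  F_self : ∀ x, C.F x x = Set.univ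
  I_self : ∀ x, C.I x x = Set.univ
  φ_self : ∀ (x : S) (a : C.F x x), (C.φ x x a : L x) = a
  γ_of_nonempty : ∀ x y z, x ≤ y → C.γ x y → y ≤ z → C.γ y z →
    (C.I x y ∩ C.F y z).Nonempty → C.γ x z
  F_comp : ∀ x z y, x ≤ z → z ≤ y → C.γ x y →
    C.F x y = {a | ∃ h : a ∈ C.F x z, (C.φ x z ⟨a, h⟩ : L z) ∈ C.I x z ∩ C.F z y}
  I_comp : ∀ x z y, x ≤ z → z ≤ y → C.γ x y →
    C.I x y = {b | ∃ c : C.F z y, (c : L z) ∈ C.I x z ∩ C.F z y ∧ (C.φ z y c : L y) = b}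
  φ_comp : ∀ x z y, x ≤ z → z ≤ y → C.γ x y →
    ∀ (a : L x) (h : a ∈ C.F x y) (h₁ : a ∈ C.F x z) (h₂ : (C.φ x z ⟨a, h₁⟩ : L z) ∈ C.F z y),
      (C.φ x y ⟨a, h⟩ : L y) = C.φ z y ⟨C.φ x z ⟨a, h₁⟩, h₂⟩
  I_inter : ∀ x y, C.γ x y → C.I x (x ⊔ y) ∩ C.I y (x ⊔ y) ⊆ C.I (x ⊓ y) (x ⊔ y)
  F_inter : ∀ x y, C.γ x y → C.F (x ⊓ y) x ∩ C.F (x ⊓ y) y ⊆ C.F (x ⊓ y) (x ⊔ y)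
  γ_of_covBy : ∀ x y, x ⋖ y → C.γ x y
  F_ne : ∀ x y, x ⋖ y → C.F x y ≠ Set.univ
  I_ne : ∀ x y, x ⋖ y → C.I x y ≠ Set.univ

/-- The relation `∼` on the disjoint union of the blocks. -/
def Sim (C : Connections S L) (p q : Σ x, L x) : Prop :=
  C.γ p.1 q.1 ∧ ∃ (hp : p.2 ∈ C.F p.1 (p.1 ⊔ q.1)) (hq : q.2 ∈ C.F q.1 (p.1 ⊔ q.1)),
    (C.φ p.1 (p.1 ⊔ q.1) ⟨p.2, hp⟩ : L (p.1 ⊔ q.1)) = C.φ q.1 (p.1 ⊔ q.1) ⟨q.2, hq⟩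

/-- The sum: the disjoint union of the blocks modulo `∼`. -/
def Sum (C : Connections S L) : Type (max u v) := Quot C.Sim

/-- The canonical map from the block `L x` to the sum. -/
def π (C : Connections S L) (x : S) (a : L x) : C.Sum := Quot.mk C.Sim ⟨x, a⟩

/-- The relation `≤_x` on the sum: both elements lie in the image of `L x`, and they are images of
elements comparable in `L x`. -/
def LEAt (C : Connections S L) (x : S) (p q : C.Sum) : Prop :=
  ∃ a b : L x, C.π x a = p ∧ C.π x b = q ∧ a ≤ b

/-- The order of the sum: `p ≤ q` when there are a chain `x₁ ≤ ⋯ ≤ xₙ` in the skeleton and elements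
`p = a₀ ≤_{x₁} a₁ ≤_{x₂} ⋯ ≤_{xₙ} aₙ = q` of the sum. -/
def SumLE (C : Connections S L) (p q : C.Sum) : Prop :=
  ∃ (n : ℕ) (x : Fin n → S) (a : Fin (n + 1) → C.Sum), Monotone x ∧
    (∀ i : Fin n, C.LEAt (x i) (a i.castSucc) (a i.succ)) ∧ a 0 = p ∧ a (Fin.last n) = q

end

/-- An isomorphism of modular connected systems. -/
structure Iso {S : Type u} [Lattice S] {L : S → Type v} [∀ x, Lattice (L x)]
    {S' : Type u'} [Lattice S'] {L' : S' → Type v'} [∀ x, Lattice (L' x)]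
    (C : Connections S L) (C' : Connections S' L') where
  skel : S ≃o S'
  block : ∀ x, L x ≃o L' (skel x)
  γ_iff : ∀ x y, C.γ x y ↔ C'.γ (skel x) (skel y)
  map_F : ∀ x y, x ≤ y → C.γ x y → C'.F (skel x) (skel y) = block x '' C.F x y
  map_I : ∀ x y, x ≤ y → C.γ x y → C'.I (skel x) (skel y) = block y '' C.I x y
  comm : ∀ x y, x ≤ y → C.γ x y →
    ∀ (a : L x) (h : a ∈ C.F x y) (h' : block x a ∈ C'.F (skel x) (skel y)),
      block y (C.φ x y ⟨a, h⟩) = C'.φ (skel x) (skel y) ⟨block x a, h'⟩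

end Connections

section Dissection

variable {P : Type u} [Lattice P]

/-- A complemented interval `[a, b]`, `a ≤ b`, of a lattice. -/
def IsComplementedInterval (B : Set P) : Prop :=
  ∃ a b : P, a ≤ b ∧ B = Set.Icc a b ∧ ∀ c ∈ B, ∃ d ∈ B, c ⊓ d = a ∧ c ⊔ d = b

variable (P) in
/-- A block of a lattice: an interval `[zero, one]` that is maximal under inclusion among the
complemented intervals. -/
@[ext]
structure Block where
  zero : P
  one : P
  zero_le_one : zero ≤ one
  maximal : Maximal IsComplementedInterval (Set.Icc zero one)

/-- The set of elements of a block. -/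
abbrev Block.carrier (B : Block P) : Set P := Set.Icc B.zero B.one

instance (B : Block P) : BoundedOrder B.carrier where
  top := ⟨B.one, B.zero_le_one, le_rfl⟩
  le_top a := a.2.2
  bot := ⟨B.zero, le_rfl, B.zero_le_one⟩
  bot_le a := a.2.1

variable (P) in
/-- The dissection of `P`. The skeleton is the set of blocks, each block is indexed by itself, two
blocks are in the tolerance when they meet, and the connection from `B` to `B'` is the identity of
`B ∩ B'`. -/
def dissection : Connections (Block P) (fun B => B.carrier) where
  γ B B' := (B.carrier ∩ B'.carrier).Nonempty
  F _ B' := {a | (a : P) ∈ B'.carrier}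
  I B _ := {a | (a : P) ∈ B.carrier}
  φ _ _ a := ⟨⟨a, a.2⟩, a.1.2⟩

end Dissection

end ModularGluing

/-! Each block carries its own order to the sum, so the sum is covered by partially ordered pieces
indexed by the skeleton. `IsAtlas` keeps only how these pieces overlap: for `x ≤ y` the overlap is
an upper set of block `x` and a lower set of block `y` with the same order on it, and the indices of
the blocks through a point form a convex sublattice of the skeleton. This description is self-dual,
which halves the work.

A step inside block `w` from a point of block `x` is also a step inside block `x ⊔ w`. Hence chains
can be made to climb in the skeleton, and it follows that the generated order is antisymmetric,
induces on each block its own order, and makes each block convex (`inside`, `between`). Joins come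
from pushing: in block `x`, the join of `p` with the bottom of an overlapping block `y ≥ x` is the
least element above `p` that lies in `y`. Composing pushes along covering pairs transports two
elements to a common block, where their join is taken.

All upper covers of `p` lie in the block of greatest index through `p`. Therefore covers are finite
in number and the covering conditions for semimodularity can be checked inside one modular block; in
a locally finite lattice these conditions and their duals give modularity. The same fact places
every complemented interval with minimum `a` inside the greatest-indexed block through `a`, so the
blocks of the sum are exactly the images of the given blocks.

To see that the given blocks form an atlas, axioms 3, 4 and 5 are turned into interpolation,
composition and amalgamation of connections. These make `∼` an equivalence and show that, for `x ≤
y`, two elements are identified exactly when the connection carries one to the other. -/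

namespace ModularGluing

/-! ### The lattice generated by an atlas -/

/-- A family of partial orders `R x` on subsets of `P`, indexed by a lattice `S`, that overlap in
the way in which the blocks of a glued sum overlap. The domain of `R x` is `{p | R x p p}`. -/
structure IsAtlas {S P : Type*} [Lattice S] (R : S → P → P → Prop) : Prop where
  left : ∀ {x p q}, R x p q → R x p p
  right : ∀ {x p q}, R x p q → R x q q
  trans : ∀ {x p q r}, R x p q → R x q r → R x p r
  antisymm : ∀ {x p q}, R x p q → R x q p → p = q
  sup : ∀ {x p q}, R x p p → R x q q →
    ∃ s, R x p s ∧ R x q s ∧ ∀ t, R x p t → R x q t → R x s t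
  inf : ∀ {x p q}, R x p p → R x q q →
    ∃ s, R x s p ∧ R x s q ∧ ∀ t, R x t p → R x t q → R x t s
  bot : ∀ x, ∃ z, R x z z ∧ ∀ p, R x p p → R x z p
  top : ∀ x, ∃ z, R x z z ∧ ∀ p, R x p p → R x p z
  cover : ∀ p, ∃ x, R x p p
  sup_mem : ∀ {x y p}, R x p p → R y p p → R (x ⊔ y) p p
  inf_mem : ∀ {x y p}, R x p p → R y p p → R (x ⊓ y) p p
  convex : ∀ {x y z p}, x ≤ y → y ≤ z → R x p p → R z p p → R y p p
  up : ∀ {x y p q}, x ≤ y → R y p p → R x p q → R y p q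
  down : ∀ {x y p q}, x ≤ y → R x q q → R y p q → R x p q
  meet : ∀ {x y}, x ⋖ y → ∃ p, R x p p ∧ R y p p

/-- The order generated by the orders `R x`. -/
def AtlasLE {S P : Type*} (R : S → P → P → Prop) : P → P → Prop :=
  Relation.ReflTransGen fun p q => ∃ x, R x p q

/-- The dual of a family of relations. -/
def dualAtlas {S P : Type*} (R : S → P → P → Prop) (x : Sᵒᵈ) (p q : P) : Prop :=
  R (OrderDual.ofDual x) q p

theorem atlasLE_dual {S P : Type*} {R : S → P → P → Prop} {p q : P} :
    AtlasLE (dualAtlas R) p q ↔ AtlasLE R q p :=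
  Relation.reflTransGen_swap (r := fun p q => ∃ x, R x p q)

theorem AtlasLE.of {S P : Type*} {R : S → P → P → Prop} (x : S) {p q : P} (hpq : R x p q) :
    AtlasLE R p q :=
  Relation.ReflTransGen.single ⟨x, hpq⟩

namespace IsAtlas

variable {S P : Type*} [Lattice S] {R : S → P → P → Prop}

theorem dual (h : IsAtlas R) : IsAtlas (dualAtlas R) where
  left := fun a => h.right a
  right := fun a => h.left a
  trans := fun a b => h.trans b a
  antisymm := fun a b => h.antisymm b a
  sup := fun a b => h.inf a b
  inf := fun a b => h.sup a b
  bot := fun x => h.top (OrderDual.ofDual x)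
  top := fun x => h.bot (OrderDual.ofDual x)
  cover := fun p => h.cover p
  sup_mem := fun a b => h.inf_mem a b
  inf_mem := fun a b => h.sup_mem a b
  convex := fun a b c d => h.convex b a d c
  up := fun a b c => h.down a b c
  down := fun a b c => h.up a b c
  meet := fun a => (h.meet a.ofDual).imp fun _ b => b.symm

/-- Each step of a chain, taken in block `w`, can be redone in the join of `w` with the current
index, so the index only rises along the chain. -/
theorem exists_ge (h : IsAtlas R) {p r : P} (hpr : AtlasLE R p r) {x : S} (hx : R x p p) :
    ∃ w, x ≤ w ∧ R w r r := by
  induction hpr using Relation.ReflTransGen.head_induction_on generalizing x with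
  | refl => exact ⟨x, le_rfl, hx⟩
  | head hpa _ ih =>
    obtain ⟨w, hw⟩ := hpa
    obtain ⟨v, hv, hr⟩ := ih (h.right (h.up le_sup_right (h.sup_mem hx (h.left hw)) hw))
    exact ⟨v, le_sup_left.trans hv, hr⟩

theorem exists_le (h : IsAtlas R) {p r : P} (hpr : AtlasLE R p r) {x : S} (hx : R x r r) :
    ∃ w, w ≤ x ∧ R w p p :=
  h.dual.exists_ge (atlasLE_dual.2 hpr) (x := OrderDual.toDual x) hx

theorem inside (h : IsAtlas R) {p r : P} (hpr : AtlasLE R p r) {x : S} (hp : R x p p)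
    (hr : R x r r) : R x p r := by
  induction hpr using Relation.ReflTransGen.head_induction_on generalizing x with
  | refl => exact hp
  | head hpa har ih =>
    obtain ⟨w, hw⟩ := hpa
    have hpa := h.up le_sup_right (h.sup_mem hp (h.left hw)) hw
    obtain ⟨v, hv, hv'⟩ := h.exists_ge har (h.right hpa)
    -- The comparison in `x ⊔ w` ends at `r`, which lies in block `x`; the overlap is a lower set of
    -- block `x ⊔ w`, so the comparison descends to `x`.
    have har := h.down le_sup_left hr (ih (h.right hpa) (h.convex le_sup_left hv hr hv'))
    exact h.trans (h.down le_sup_left (h.left har) hpa) har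

theorem between (h : IsAtlas R) {p q r : P} (hpq : AtlasLE R p q) (hqr : AtlasLE R q r) {x : S}
    (hp : R x p p) (hr : R x r r) : R x q q := by
  obtain ⟨w, hw, hwq⟩ := h.exists_ge hpq hp
  obtain ⟨v, hv, hvr⟩ := h.exists_ge hqr hwq
  exact h.left (h.down hw hr (h.inside hqr hwq (h.convex hw hv hr hvr)))

theorem le_antisymm (h : IsAtlas R) {p q : P} (hpq : AtlasLE R p q) (hqp : AtlasLE R q p) :
    p = q := by
  obtain ⟨x, hx⟩ := h.cover p
  have hq := h.between hpq hqp hx hx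
  exact h.antisymm (h.inside hpq hx hq) (h.inside hqp hq hx)

/-- `q` is the least element above `p` in the block `x` that lies in the block `y`. -/
def IsPush (R : S → P → P → Prop) (x y : S) (p q : P) : Prop :=
  R x p q ∧ R y q q ∧ ∀ t, R x p t → R y t t → R x q t

/-- The witness is the join, in block `x`, of `p` and the bottom of block `y`. That bottom lies in
block `x` because it is below the common point `m`. -/
theorem exists_isPush (h : IsAtlas R) {x y : S} (hxy : x ≤ y) {m : P} (hmx : R x m m)
    (hmy : R y m m) {p : P} (hp : R x p p) : ∃ q, IsPush R x y p q := by
  obtain ⟨z, hz, hzy⟩ := h.bot y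
  have hzx := h.left (h.down hxy hmx (hzy m hmy))
  obtain ⟨s, hps, hzs, hs⟩ := h.sup hp hzx
  exact ⟨s, hps, h.right (h.up hxy hz hzs), fun t hpt ht =>
    hs t hpt (h.down hxy (h.right hpt) (hzy t ht))⟩

/-- The push does not change when the chain of `IsPush.le` moves the current index up to `x'`. For a
competitor `t`, the meet of `q` and `t` in block `x'` also lies in blocks `x` and `y`, so the
minimality of `q` applies to it. -/
theorem IsPush.sup (h : IsAtlas R) {x y x' : S} (hxy : x ≤ y) (hxx : x ≤ x') {p q : P}
    (hpq : IsPush R x y p q) (hp : R x' p p) : IsPush R x' (x' ⊔ y) p q := by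
  obtain ⟨h₁, h₂, h₃⟩ := hpq
  have h₁' := h.up hxx hp h₁
  have hq := h.right h₁'
  have hq' := h.sup_mem hq h₂
  refine ⟨h₁', hq', fun t hpt ht => ?_⟩
  obtain ⟨s, hsq, hst, hs⟩ := h.inf hq (h.right hpt)
  have hps := hs p h₁' hpt
  have hsq' := h.down hxx (h.right h₁) hsq
  obtain ⟨z, hz, hz'⟩ := h.bot (x' ⊔ y)
  -- The bottom `z` of block `x' ⊔ y` is below both `q` and `t`, hence below `s`. This puts `s` in
  -- that block, and convexity of the index set then puts it in `y`.
  have hzs := hs z (h.down le_sup_left hq (hz' q hq')) (h.down le_sup_left (h.right hpt) (hz' t ht))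
  have hsy := h.convex hxy le_sup_right (h.left hsq') (h.right (h.up le_sup_left hz hzs))
  have := h₃ s (h.down hxx (h.left hsq') hps) hsy
  exact h.trans (h.up hxx hq this) hst

/-- The minimality of a push, local to one block by definition, becomes global. Along a chain from
`p` to `r`, each point is pushed to a block that rises with the chain, and the pushes increase. -/
theorem IsPush.le (h : IsAtlas R) {p r : P} (hpr : AtlasLE R p r) {x y z : S} {q : P}
    (hxy : x ≤ y) (hpq : IsPush R x y p q) (hyz : y ≤ z) (hr : R z r r) : AtlasLE R q r := by
  induction hpr using Relation.ReflTransGen.head_induction_on generalizing x y z q with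
  | refl =>
    have hx := h.left hpq.1
    exact AtlasLE.of x (hpq.2.2 _ hx (h.convex hxy hyz hx hr))
  | head hpa har ih =>
    obtain ⟨w, hw⟩ := hpa
    have hx' := h.sup_mem (h.left hpq.1) (h.left hw)
    have hpa := h.up le_sup_right hx' hw
    have hpq' := IsPush.sup h hxy le_sup_left hpq hx'
    obtain ⟨b, hb⟩ := h.exists_isPush le_sup_left (h.right hpq'.1) hpq'.2.1 (h.right hpa)
    obtain ⟨v, hv, hv'⟩ := h.exists_ge har (h.right hpa)
    exact (AtlasLE.of _ (hpq'.2.2 b (h.trans hpa hb.1) hb.2.1)).trans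
      (ih le_sup_left hb (sup_le_sup hv hyz) (h.sup_mem hv' hr))

/-- Blocks far apart may be disjoint, so the push is composed along a chain of covering pairs, whose
blocks meet. -/
theorem exists_push (h : IsAtlas R) (hS : ∀ a b : S, (Set.Icc a b).Finite) {x y : S} (hxy : x ≤ y)
    {p : P} (hp : R x p p) : ∃ q, R y q q ∧ AtlasLE R p q ∧
      ∀ r z, y ≤ z → R z r r → AtlasLE R p r → AtlasLE R q r := by
  let _ : LocallyFiniteOrder S := LocallyFiniteOrder.ofFiniteIcc hS
  induction le_iff_reflTransGen_covBy.1 hxy with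
  | refl => exact ⟨p, hp, .refl, fun _ _ _ _ hr => hr⟩
  | @tail b c hab hbc ih =>
    obtain ⟨q, hq, hpq, hu⟩ := ih (le_iff_reflTransGen_covBy.2 hab)
    obtain ⟨m, hm, hm'⟩ := h.meet hbc
    obtain ⟨s, hs⟩ := h.exists_isPush hbc.le hm hm' hq
    exact ⟨s, hs.2.1, hpq.trans (AtlasLE.of b hs.1), fun r z hz hr hpr =>
      IsPush.le h (hu r z (hbc.le.trans hz) hr hpr) hbc.le hs hz hr⟩

theorem exists_pull (h : IsAtlas R) (hS : ∀ a b : S, (Set.Icc a b).Finite) {x y : S} (hxy : y ≤ x)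
    {p : P} (hp : R x p p) : ∃ q, R y q q ∧ AtlasLE R q p ∧
      ∀ r z, z ≤ y → R z r r → AtlasLE R r p → AtlasLE R r q := by
  obtain ⟨q, h₁, h₂, h₃⟩ := h.dual.exists_push (x := OrderDual.toDual x) (y := OrderDual.toDual y)
    (fun a b => by
      refine (hS (OrderDual.ofDual b) (OrderDual.ofDual a)).subset ?_
      exact fun z hz => ⟨hz.2, hz.1⟩) hxy hp
  exact ⟨q, h₁, atlasLE_dual.1 h₂, fun r z hz hr hpr =>
    atlasLE_dual.1 (h₃ r (OrderDual.toDual z) hz hr (atlasLE_dual.2 hpr))⟩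

theorem exists_lub (h : IsAtlas R) (hS : ∀ a b : S, (Set.Icc a b).Finite) (p q : P) :
    ∃ s, AtlasLE R p s ∧ AtlasLE R q s ∧
      ∀ r, AtlasLE R p r → AtlasLE R q r → AtlasLE R s r := by
  obtain ⟨x, hx⟩ := h.cover p
  obtain ⟨y, hy⟩ := h.cover q
  obtain ⟨p', hp', hpp', hup⟩ := h.exists_push hS (le_sup_left : x ≤ x ⊔ y) hx
  obtain ⟨q', hq', hqq', huq⟩ := h.exists_push hS (le_sup_right : y ≤ x ⊔ y) hy
  obtain ⟨s, hps, hqs, hs⟩ := h.sup hp' hq'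
  refine ⟨s, hpp'.trans (AtlasLE.of _ hps), hqq'.trans (AtlasLE.of _ hqs), fun r hpr hqr => ?_⟩
  obtain ⟨w, hw, hwr⟩ := h.exists_ge hpr hx
  obtain ⟨v, hv, hvr⟩ := h.exists_ge hqr hy
  have hle := sup_le_sup hw hv
  have hr := h.sup_mem hwr hvr
  -- The upper bound `r` may lie in a higher block. Pulling it back to `x ⊔ y` gives an upper bound
  -- of `p'` and `q'` within the block where `s` is their join.
  obtain ⟨t, ht, htr, hut⟩ := h.exists_pull hS hle hr
  have h₁ := hut p' _ le_rfl hp' (hup r _ hle hr hpr)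
  have h₂ := hut q' _ le_rfl hq' (huq r _ hle hr hqr)
  exact (AtlasLE.of _ (hs t (h.inside h₁ hp' ht) (h.inside h₂ hq' ht))).trans htr

theorem exists_lattice (h : IsAtlas R) (hS : ∀ a b : S, (Set.Icc a b).Finite) :
    ∃ _ : Lattice P, ∀ p q : P, p ≤ q ↔ AtlasLE R p q := by
  have hS' : ∀ a b : Sᵒᵈ, (Set.Icc a b).Finite := fun a b =>
    (hS (OrderDual.ofDual b) (OrderDual.ofDual a)).subset fun z hz => ⟨hz.2, hz.1⟩
  choose s hs₁ hs₂ hs₃ using h.exists_lub hS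
  choose i hi₁ hi₂ hi₃ using h.dual.exists_lub hS'
  simp only [atlasLE_dual] at hi₁ hi₂ hi₃
  exact ⟨{
    le := AtlasLE R
    le_refl := fun _ => .refl
    le_trans := fun _ _ _ => .trans
    le_antisymm := fun _ _ => h.le_antisymm
    sup := s
    le_sup_left := hs₁
    le_sup_right := hs₂
    sup_le := fun a b c => hs₃ a b c
    inf := i
    inf_le_left := hi₁
    inf_le_right := hi₂
    le_inf := fun a b c => hi₃ b c a }, fun _ _ => Iff.rfl⟩

end IsAtlas

/-! ### Modularity from covering conditions -/

section Modularity

variable {P : Type*} [Lattice P]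

theorem IsUpperModularLattice.of_isWeakUpperModularLattice [IsWeakUpperModularLattice P]
    (hP : ∀ a b : P, (Set.Icc a b).Finite) : IsUpperModularLattice P where
  covBy_sup_of_inf_covBy {a b} hab := by
    let _ : LocallyFiniteOrder P := LocallyFiniteOrder.ofFiniteIcc hP
    have hnle : ¬ a ≤ b := fun h => hab.lt.ne (inf_eq_left.2 h)
    have hob := inf_le_right (a := a) (b := b)
    -- With `o` fixed, the upper end `b` climbs from `o` by covers; the weak condition is applied to
    -- `a ⊔ c` and `d`, two covers of `c`.
    generalize a ⊓ b = o at hab hob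
    induction le_iff_reflTransGen_covBy.1 hob with
    | refl => rwa [sup_eq_left.2 hab.le]
    | @tail c d _ hcd ih =>
      have hac : ¬ a ≤ c := fun h => hnle (h.trans hcd.le)
      have hc := ih hac (le_iff_reflTransGen_covBy.2 ‹_›)
      have hinf : (a ⊔ c) ⊓ d = c := by
        rcases hcd.eq_or_eq (le_inf le_sup_right hcd.le : c ≤ (a ⊔ c) ⊓ d) inf_le_right with h | h
        · exact h
        · rcases hc.eq_or_eq hcd.le (inf_eq_right.1 h) with h' | h'
          · exact absurd h' hcd.lt.ne'
          · exact absurd (h' ▸ le_sup_left) hnle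
      have := covBy_sup_of_inf_covBy_of_inf_covBy_right (a := a ⊔ c) (b := d)
        (by rwa [hinf]) (by rwa [hinf])
      rwa [sup_assoc, sup_eq_right.2 hcd.le] at this

theorem IsLowerModularLattice.of_isWeakLowerModularLattice [IsWeakLowerModularLattice P]
    (hP : ∀ a b : P, (Set.Icc a b).Finite) : IsLowerModularLattice P where
  inf_covBy_of_covBy_sup {a b} hab := by
    have := IsUpperModularLattice.of_isWeakUpperModularLattice (P := Pᵒᵈ) fun a b =>
      (hP (OrderDual.ofDual b) (OrderDual.ofDual a)).subset fun z hz => ⟨hz.2, hz.1⟩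
    exact (covBy_sup_of_inf_covBy_left (α := Pᵒᵈ) (a := OrderDual.toDual a)
      (b := OrderDual.toDual b) hab.toDual).ofDual

/-- A pentagon whose long side contains a cover `a ⋖ c` yields one with a smaller interval `[a ⊓ b,
b]`, unless `a ⊓ b ⋖ b`; in that case `a ⋖ a ⊔ b`, which leaves no room for `c`. -/
theorem not_pentagon [IsUpperModularLattice P] [IsLowerModularLattice P]
    (hP : ∀ a b : P, (Set.Icc a b).Finite) (n : ℕ) :
    ∀ {a b c : P}, (Set.Icc (a ⊓ b) b).ncard = n → a ⋖ c → c ⊓ b = a ⊓ b → c ⊔ b ≠ a ⊔ b := by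
  let _ : LocallyFiniteOrder P := LocallyFiniteOrder.ofFiniteIcc hP
  induction n using Nat.strong_induction_on with
  | _ n ih =>
    intro a b c hn hac hinf hsup
    have hob : a ⊓ b < b := by
      refine lt_of_le_of_ne inf_le_right fun h => hac.lt.ne ?_
      rw [← sup_eq_left.2 (inf_eq_right.1 h), ← hsup, sup_eq_left.2 (inf_eq_right.1 (hinf.trans h))]
    obtain ⟨b₁, hob₁, hb₁⟩ := exists_covBy_le_of_lt hob
    have hb₁c : ¬ b₁ ≤ c := fun h => hob₁.lt.not_ge (hinf ▸ le_inf h hb₁)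
    have hba : b₁ ⊓ a = a ⊓ b := le_antisymm (le_inf inf_le_right (inf_le_left.trans hb₁))
      (le_inf hob₁.le inf_le_left)
    have haA : a ⋖ b₁ ⊔ a := covBy_sup_of_inf_covBy_left (by rwa [hba])
    have hAc : (b₁ ⊔ a) ⊓ c = a := by
      rcases hac.eq_or_eq (le_inf le_sup_right hac.le : a ≤ (b₁ ⊔ a) ⊓ c) inf_le_right with h | h
      · exact h
      · rcases haA.eq_or_eq hac.le (inf_eq_right.1 h) with h' | h'
        · exact absurd h' hac.lt.ne'
        · exact absurd (h' ▸ le_sup_left) hb₁c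
    have hAC : b₁ ⊔ a ⋖ b₁ ⊔ a ⊔ c := covBy_sup_of_inf_covBy_right (by rwa [hAc])
    have hCeq : b₁ ⊔ a ⊔ c = b₁ ⊔ c := by rw [sup_assoc, sup_eq_right.2 hac.le]
    -- If `C ⊓ b ≤ A`, where `A = b₁ ⊔ a` and `C = A ⊔ c`, then `A`, `C`, `b` form a pentagon with a
    -- smaller interval, since `b₁ ≤ A ⊓ b`. Otherwise `t = C ⊓ b` can replace `b`, with `a ⊔ t = c
    -- ⊔ t = C`.
    by_cases hle : (b₁ ⊔ a ⊔ c) ⊓ b ≤ b₁ ⊔ a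
    · refine ih _ ?_ rfl hAC (le_antisymm (le_inf hle inf_le_right)
        (inf_le_inf_right _ le_sup_left)) ?_
      · rw [← hn]
        refine Set.ncard_lt_ncard ⟨Set.Icc_subset_Icc_left (inf_le_inf_right _ le_sup_right),
          fun h => ?_⟩ (hP _ _)
        exact hob₁.lt.not_ge ((le_inf le_sup_left hb₁).trans (h ⟨le_rfl, hob.le⟩).1)
      · rw [hCeq, sup_assoc, hsup, sup_assoc]
    · have hCt : b₁ ⊔ a ⊔ (b₁ ⊔ a ⊔ c) ⊓ b = b₁ ⊔ a ⊔ c := by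
        rcases hAC.eq_or_eq le_sup_left (sup_le hAC.le inf_le_left) with h | h
        · exact absurd (sup_eq_left.1 h) hle
        · exact h
      have hb₁t : b₁ ≤ (b₁ ⊔ a ⊔ c) ⊓ b := le_inf (le_sup_left.trans le_sup_left) hb₁
      set C := b₁ ⊔ a ⊔ c with hC
      set t := C ⊓ b with ht
      have hat : a ⊔ t = C := by
        rw [← hCt]
        exact le_antisymm (sup_le_sup_right le_sup_right _)
          (sup_le (sup_le (hb₁t.trans le_sup_right) le_sup_left) le_sup_right)
      have hct : c ⊔ t = C := le_antisymm (sup_le le_sup_right inf_le_left)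
        (hat ▸ sup_le_sup_right hac.le _)
      have hait : a ⊓ t = a ⊓ b := le_antisymm (inf_le_inf_left _ inf_le_right)
        (le_inf inf_le_left (hob₁.le.trans hb₁t))
      have hcit : c ⊓ t = a ⊓ b := le_antisymm (hinf ▸ inf_le_inf_left _ inf_le_right)
        (hait ▸ inf_le_inf_right _ hac.le)
      rcases (show t ≤ b from inf_le_right).lt_or_eq with hlt | heq
      · refine ih _ ?_ rfl hac (hcit.trans hait.symm) (hct.trans hat.symm)
        rw [← hn, hait]
        refine Set.ncard_lt_ncard ⟨Set.Icc_subset_Icc_right hlt.le, fun h => ?_⟩ (hP _ _)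
        exact hlt.not_ge (h ⟨hob.le, le_rfl⟩).2
      -- Now `t = b`. Going up from `a ⊓ b ⋖ b₁` gives `c ⋖ C`, going down gives `a ⊓ b ⋖ b`, and
      -- going up again gives `a ⋖ C`, although `a < c < C`.
      · have hcC : c ⋖ C := by
          rw [hCeq]
          refine covBy_sup_of_inf_covBy_left ?_
          have : b₁ ⊓ c = a ⊓ b := le_antisymm
            (hinf ▸ le_inf inf_le_right (inf_le_left.trans hb₁))
            (le_inf hob₁.le (inf_le_left.trans hac.le))
          rwa [this]
        rw [heq] at hct hat
        have hob' : a ⊓ b ⋖ b := by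
          rw [← hinf]
          exact inf_covBy_of_covBy_sup_left (hct.symm ▸ hcC)
        have : a ⋖ C := hat ▸ covBy_sup_of_inf_covBy_right hob'
        exact this.2 hac.lt hcC.lt

theorem isModularLattice_of_isWeakUpper_of_isWeakLower [IsWeakUpperModularLattice P]
    [IsWeakLowerModularLattice P] (hP : ∀ a b : P, (Set.Icc a b).Finite) :
    IsModularLattice P where
  sup_inf_le_assoc_of_le {x} y {z} hxz := by
    have := IsUpperModularLattice.of_isWeakUpperModularLattice hP
    have := IsLowerModularLattice.of_isWeakLowerModularLattice hP
    let _ : LocallyFiniteOrder P := LocallyFiniteOrder.ofFiniteIcc hP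
    by_contra hne
    have hle : x ⊔ y ⊓ z ≤ (x ⊔ y) ⊓ z :=
      le_inf (sup_le_sup_left inf_le_left _) (sup_le hxz inf_le_right)
    obtain ⟨c, hc, hcz⟩ := exists_covBy_le_of_lt (lt_of_le_not_ge hle hne)
    have hcz' := le_inf_iff.1 hcz
    refine not_pentagon hP _ (b := y) rfl hc (le_antisymm ?_ (inf_le_inf_right _ hc.le))
      (le_antisymm ?_ (sup_le_sup_right hc.le _))
    · exact le_inf ((le_inf inf_le_right (inf_le_left.trans hcz'.2)).trans le_sup_right)
        inf_le_right
    · exact sup_le (hcz'.1.trans (sup_le (le_sup_left.trans le_sup_left) le_sup_right)) le_sup_right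

end Modularity

/-! ### Finiteness, modularity and the blocks of an atlas lattice -/

/-- A lattice whose order is generated by an atlas of finite modular blocks `[lo x, hi x]`, where
neither of the blocks of a covering pair of indices contains the other one. -/
structure IsAtlasLattice {S P : Type*} [Lattice S] [Lattice P] (R : S → P → P → Prop)
    (lo hi : S → P) : Prop extends IsAtlas R where
  le_iff : ∀ p q : P, p ≤ q ↔ AtlasLE R p q
  lo_mem : ∀ x, R x (lo x) (lo x)
  hi_mem : ∀ x, R x (hi x) (hi x)
  lo_le : ∀ {x p}, R x p p → R x (lo x) p
  le_hi : ∀ {x p}, R x p p → R x p (hi x)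
  lo_ne : ∀ {x y}, x ⋖ y → lo x ≠ lo y
  hi_ne : ∀ {x y}, x ⋖ y → hi x ≠ hi y
  skeleton_finite : ∀ a b : S, (Set.Icc a b).Finite
  block_finite : ∀ x, {p | R x p p}.Finite
  block_modular : ∀ {x a b c}, R x a a → R x b b → R x c c → a ≤ c → (a ⊔ b) ⊓ c ≤ a ⊔ b ⊓ c

namespace IsAtlasLattice

variable {S P : Type*} [Lattice S] [Lattice P] {R : S → P → P → Prop} {lo hi : S → P}

theorem dual (h : IsAtlasLattice R lo hi) :
    IsAtlasLattice (S := Sᵒᵈ) (P := Pᵒᵈ) (dualAtlas R) hi lo where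
  toIsAtlas := h.toIsAtlas.dual
  le_iff := fun p q => (h.le_iff q p).trans atlasLE_dual.symm
  lo_mem := fun x => h.hi_mem x
  hi_mem := fun x => h.lo_mem x
  lo_le := fun a => h.le_hi a
  le_hi := fun a => h.lo_le a
  lo_ne := fun a => (h.hi_ne a.ofDual).symm
  hi_ne := fun a => (h.lo_ne a.ofDual).symm
  skeleton_finite := fun a b =>
    (h.skeleton_finite (OrderDual.ofDual b) (OrderDual.ofDual a)).subset fun _ hz => ⟨hz.2, hz.1⟩
  block_finite := fun x => h.block_finite x
  block_modular := fun {x a b c} ha hb hc hac => by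
    change OrderDual.ofDual a ⊓ (OrderDual.ofDual b ⊔ OrderDual.ofDual c) ≤
      OrderDual.ofDual a ⊓ OrderDual.ofDual b ⊔ OrderDual.ofDual c
    rw [inf_comm, sup_comm (OrderDual.ofDual b), sup_comm (_ ⊓ _), inf_comm (OrderDual.ofDual a)]
    exact h.block_modular hc hb ha hac

theorem mem_iff (h : IsAtlasLattice R lo hi) {x : S} {p : P} :
    R x p p ↔ p ∈ Set.Icc (lo x) (hi x) := by
  refine ⟨fun hp => ⟨(h.le_iff _ _).2 (.of x (h.lo_le hp)), (h.le_iff _ _).2 (.of x (h.le_hi hp))⟩,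
    fun hp => h.between ((h.le_iff _ _).1 hp.1) ((h.le_iff _ _).1 hp.2) (h.lo_mem x) (h.hi_mem x)⟩

theorem lo_le_hi (h : IsAtlasLattice R lo hi) (x : S) : lo x ≤ hi x := (h.mem_iff.1 (h.lo_mem x)).2

theorem lo_lt_of_covBy (h : IsAtlasLattice R lo hi) {x y : S} (hxy : x ⋖ y) : lo x < lo y := by
  obtain ⟨m, hm, hm'⟩ := h.meet hxy
  refine lt_of_le_of_ne ?_ (h.lo_ne hxy)
  exact (h.mem_iff.1 (h.left (h.down hxy.le hm (h.lo_le hm')))).1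

theorem lo_strictMono (h : IsAtlasLattice R lo hi) : StrictMono lo := by
  let _ : LocallyFiniteOrder S := LocallyFiniteOrder.ofFiniteIcc h.skeleton_finite
  have hmono : Monotone lo := fun x y hxy => by
    induction le_iff_reflTransGen_covBy.1 hxy with
    | refl => exact le_rfl
    | tail hab hbc ih =>
      exact (ih (le_iff_reflTransGen_covBy.2 hab)).trans (h.lo_lt_of_covBy hbc).le
  intro x y hxy
  obtain ⟨z, hz, hzy⟩ := exists_covBy_le_of_lt hxy
  exact (h.lo_lt_of_covBy hz).trans_le (hmono hzy)

/-- If `lo x ≤ lo y`, then `lo y` lies in some block `w ≥ x` and so in block `w ⊔ y`, whose bottom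
is therefore at most `lo y`. Strict monotonicity forces `w ≤ y`. -/
theorem lo_le_iff (h : IsAtlasLattice R lo hi) {x y : S} : lo x ≤ lo y ↔ x ≤ y := by
  refine ⟨fun hle => ?_, fun hxy => h.lo_strictMono.monotone hxy⟩
  obtain ⟨w, hw, hw'⟩ := h.exists_ge ((h.le_iff _ _).1 hle) (h.lo_mem x)
  have := (h.mem_iff.1 (h.sup_mem hw' (h.lo_mem y))).1
  have hwy : w ⊔ y = y := by
    by_contra hne
    exact this.not_gt (h.lo_strictMono (lt_of_le_of_ne le_sup_right (Ne.symm hne)))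
  exact hw.trans (sup_eq_right.1 hwy)

theorem hi_le_iff (h : IsAtlasLattice R lo hi) {x y : S} : hi x ≤ hi y ↔ x ≤ y :=
  h.dual.lo_le_iff (x := OrderDual.toDual y) (y := OrderDual.toDual x)

theorem eq_of_Icc_subset (h : IsAtlasLattice R lo hi) {x y : S}
    (hxy : Set.Icc (lo x) (hi x) ⊆ Set.Icc (lo y) (hi y)) : x = y :=
  le_antisymm (h.hi_le_iff.1 (hxy ⟨h.lo_le_hi x, le_rfl⟩).2)
    (h.lo_le_iff.1 (hxy ⟨le_rfl, h.lo_le_hi x⟩).1)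

theorem finite_Icc (h : IsAtlasLattice R lo hi) (p q : P) : (Set.Icc p q).Finite := by
  by_cases hpq : p ≤ q
  · obtain ⟨x, hx⟩ := h.cover p
    obtain ⟨y, hxy, hy⟩ := h.exists_ge ((h.le_iff _ _).1 hpq) hx
    refine ((h.skeleton_finite x y).biUnion fun w _ => h.block_finite w).subset fun r hr => ?_
    obtain ⟨w, hw, hwr⟩ := h.exists_ge ((h.le_iff _ _).1 hr.1) hx
    obtain ⟨v, hv, hvr⟩ := h.exists_le ((h.le_iff _ _).1 hr.2) hy
    -- The point `r` lies in blocks `w ⊓ v` and `w`, hence in block `w ⊓ y`, whose index is in the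
    -- finite interval `[x, y]`.
    have := h.convex (inf_le_inf_left w hv) inf_le_left (h.inf_mem hwr hvr) hwr
    exact Set.mem_biUnion (x := w ⊓ y) ⟨le_inf hw hxy, inf_le_right⟩ this
  · simp [Set.Icc_eq_empty hpq]

theorem exists_greatest_index (h : IsAtlasLattice R lo hi) (p : P) :
    ∃ t, R t p p ∧ ∀ w, R w p p → w ≤ t := by
  obtain ⟨x, hx⟩ := h.cover p
  -- For such `y` the bottom `lo y` is below `p` and so lies in the finite block `x`; and `lo` is
  -- injective.
  have hfin : {y | x ≤ y ∧ R y p p}.Finite := by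
    refine Set.Finite.of_finite_image (f := lo) ((h.block_finite x).subset ?_)
      fun a _ b _ hab => le_antisymm (h.lo_le_iff.1 hab.le) (h.lo_le_iff.1 hab.ge)
    rintro _ ⟨y, ⟨hxy, hy⟩, rfl⟩
    exact h.left (h.down hxy hx (h.lo_le hy))
  obtain ⟨t, ⟨hxt, ht⟩, hmax⟩ := hfin.exists_maximal ⟨x, le_rfl, hx⟩
  refine ⟨t, ht, fun w hw => le_sup_right.trans (hmax (y := t ⊔ w) ?_ le_sup_left)⟩
  exact ⟨hxt.trans le_sup_left, h.sup_mem ht hw⟩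

theorem exists_index_of_covBy (h : IsAtlasLattice R lo hi) {p q : P} (hpq : p ⋖ q) :
    ∃ x, R x p q := by
  have hle := (h.le_iff _ _).1 hpq.le
  have hne := hpq.lt.ne
  have key : ∀ r, AtlasLE R r q → r = p → ∃ x, R x p q := by
    intro r hr
    induction hr using Relation.ReflTransGen.head_induction_on with
    | refl => exact fun h => absurd h.symm hne
    | @head a c hac hcq ih =>
      rintro rfl
      obtain ⟨x, hx⟩ := hac
      rcases hpq.eq_or_eq ((h.le_iff _ _).2 (.of x hx)) ((h.le_iff _ _).2 hcq) with hc | hc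
      · exact ih hc
      · exact ⟨x, hc ▸ hx⟩
  exact key p hle rfl

/-- A generating chain from `p` to a cover `q` must jump inside a single block through `p`, and that
jump lifts to the greatest block through `p`. -/
theorem rel_of_covBy (h : IsAtlasLattice R lo hi) {p q : P} (hpq : p ⋖ q) {t : S}
    (ht : R t p p) (hmax : ∀ w, R w p p → w ≤ t) : R t p q := by
  obtain ⟨x, hx⟩ := h.exists_index_of_covBy hpq
  exact h.up (hmax x (h.left hx)) ht hx

theorem finite_upper (h : IsAtlasLattice R lo hi) (p : P) : {q | p ⋖ q}.Finite := by
  obtain ⟨t, ht, hmax⟩ := h.exists_greatest_index p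
  exact (h.block_finite t).subset fun q hq => h.right (h.rel_of_covBy hq ht hmax)

theorem isLFFC (h : IsAtlasLattice R lo hi) : IsLFFC P where
  finite_Icc := h.finite_Icc
  finite_upper := h.finite_upper
  finite_lower p := (h.dual.finite_upper (OrderDual.toDual p)).subset fun _ hq => CovBy.toDual hq

theorem covBy_sup (h : IsAtlasLattice R lo hi) {p q r : P} (hpq : p ⋖ q) (hpr : p ⋖ r)
    (hqr : q ≠ r) : q ⋖ q ⊔ r := by
  obtain ⟨t, ht, hmax⟩ := h.exists_greatest_index p
  have hq := h.right (h.rel_of_covBy hpq ht hmax)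
  have hr := h.right (h.rel_of_covBy hpr ht hmax)
  have hrq : ¬ r ≤ q := fun hle => by
    rcases hpq.eq_or_eq hpr.le hle with h' | h'
    · exact hpr.lt.ne' h'
    · exact hqr h'.symm
  refine ⟨lt_of_le_of_ne le_sup_left fun h' => hrq (h' ▸ le_sup_right), fun s hqs hs => ?_⟩
  have hq' := h.mem_iff.1 hq
  have hs' : R t s s := h.mem_iff.2 ⟨hq'.1.trans hqs.le, hs.le.trans
    (sup_le hq'.2 (h.mem_iff.1 hr).2)⟩
  have hmod := (le_inf hs.le le_rfl).trans (h.block_modular hq hr hs' hqs.le)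
  rcases hpr.eq_or_eq (le_inf hpr.le (hpq.le.trans hqs.le)) inf_le_left with h' | h'
  · rw [h', sup_eq_left.2 hpq.le] at hmod
    exact hqs.not_ge hmod
  · exact hs.not_ge (sup_le hqs.le (inf_eq_left.1 h'))

theorem isModularLattice (h : IsAtlasLattice R lo hi) : IsModularLattice P := by
  have : IsWeakUpperModularLattice P := ⟨fun {a b} ha hb => by
    by_cases hab : a = b
    · subst hab
      simp at ha
    · exact h.covBy_sup ha hb hab⟩
  have : IsWeakLowerModularLattice P := ⟨fun {a b} ha hb => by
    by_cases hab : a = b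
    · subst hab
      simp at ha
    · exact (h.dual.covBy_sup (p := OrderDual.toDual (a ⊔ b)) (q := OrderDual.toDual a)
        (r := OrderDual.toDual b) ha.toDual hb.toDual hab).ofDual⟩
  exact isModularLattice_of_isWeakUpper_of_isWeakLower h.finite_Icc

theorem exists_subset_of_isComplementedInterval (h : IsAtlasLattice R lo hi) {B : Set P}
    (hB : IsComplementedInterval B) : ∃ x, B ⊆ Set.Icc (lo x) (hi x) := by
  let _ : LocallyFiniteOrder P := LocallyFiniteOrder.ofFiniteIcc h.finite_Icc
  obtain ⟨a, b, hab, rfl, hc⟩ := hB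
  obtain ⟨t, ht, hmax⟩ := h.exists_greatest_index a
  have ha := h.mem_iff.1 ht
  refine ⟨t, Set.Icc_subset_Icc ha.1 ?_⟩
  -- A complement `d` of `b ⊓ hi t` must be `a`: a cover of `a` below `d` would lie in block `t`,
  -- hence below `b ⊓ hi t`, contradicting `hinf`. Thus `b ⊓ hi t = b`.
  obtain ⟨d, hd, hinf, hsup⟩ := hc (b ⊓ hi t) ⟨le_inf hab ha.2, inf_le_left⟩
  have hda : a = d := by
    by_contra hne
    obtain ⟨e, he, hed⟩ := exists_covBy_le_of_lt (lt_of_le_of_ne hd.1 hne)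
    have := (h.mem_iff.1 (h.right (h.rel_of_covBy he ht hmax))).2
    exact he.lt.not_ge (hinf ▸ le_inf (le_inf (hed.trans hd.2) this) hed)
  rw [← hda, sup_eq_left.2 (le_inf hab ha.2)] at hsup
  exact inf_eq_left.1 hsup

/-- The blocks of the atlas are complemented. -/
def Complemented (lo hi : S → P) : Prop :=
  ∀ x, ∀ c ∈ Set.Icc (lo x) (hi x), ∃ d ∈ Set.Icc (lo x) (hi x), c ⊓ d = lo x ∧ c ⊔ d = hi x

theorem maximal_Icc (h : IsAtlasLattice R lo hi) (hc : Complemented lo hi) (x : S) :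
    Maximal IsComplementedInterval (Set.Icc (lo x) (hi x)) := by
  refine ⟨⟨lo x, hi x, h.lo_le_hi x, rfl, hc x⟩, fun B hB hle => ?_⟩
  obtain ⟨y, hy⟩ := h.exists_subset_of_isComplementedInterval hB
  obtain rfl := h.eq_of_Icc_subset (hle.trans hy)
  exact hy

/-- The block with index `x`. -/
def block (h : IsAtlasLattice R lo hi) (hc : Complemented lo hi) (x : S) : Block P :=
  ⟨lo x, hi x, h.lo_le_hi x, h.maximal_Icc hc x⟩

theorem block_bijective (h : IsAtlasLattice R lo hi) (hc : Complemented lo hi) :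
    Function.Bijective (h.block hc) := by
  refine ⟨fun x y hxy => h.eq_of_Icc_subset (congrArg Block.carrier hxy).le, fun B => ?_⟩
  obtain ⟨x, hx⟩ := h.exists_subset_of_isComplementedInterval B.maximal.1
  have heq := hx.antisymm (B.maximal.2 (h.maximal_Icc hc x).1 hx)
  refine ⟨x, Block.ext ?_ ?_⟩
  · exact le_antisymm (heq.le ⟨le_rfl, B.zero_le_one⟩).1
      (heq.ge ⟨le_rfl, h.lo_le_hi x⟩).1
  · exact le_antisymm (heq.ge ⟨h.lo_le_hi x, le_rfl⟩).2 (heq.le ⟨B.zero_le_one, le_rfl⟩).2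

theorem exists_block_lattice (h : IsAtlasLattice R lo hi) (hc : Complemented lo hi) :
    ∃ _ : Lattice (Block P), (∀ B B' : Block P, B ≤ B' ↔ B.zero ≤ B'.zero) ∧
      ∃ e : S ≃o Block P, ∀ x, e x = h.block hc x := by
  let e := Equiv.ofBijective _ (h.block_bijective hc)
  have hle : ∀ B B' : Block P, B.zero ≤ B'.zero ↔ e.symm B ≤ e.symm B' := fun B B' => by
    rw [← h.lo_le_iff]
    conv_lhs => rw [← e.apply_symm_apply B, ← e.apply_symm_apply B']
    rfl
  let _ : Lattice (Block P) := {
    le := fun B B' => B.zero ≤ B'.zero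
    le_refl := fun B => le_refl B.zero
    le_trans := fun _ _ _ => le_trans
    le_antisymm := fun B B' h₁ h₂ => e.symm.injective
      (le_antisymm ((hle B B').1 h₁) ((hle B' B).1 h₂))
    sup := fun B B' => e (e.symm B ⊔ e.symm B')
    le_sup_left := fun B B' => by simp [hle]
    le_sup_right := fun B B' => by simp [hle]
    sup_le := fun B B' B'' h₁ h₂ => by
      simp only [hle] at h₁ h₂ ⊢
      simpa using ⟨h₁, h₂⟩
    inf := fun B B' => e (e.symm B ⊓ e.symm B')
    inf_le_left := fun B B' => by simp [hle]
    inf_le_right := fun B B' => by simp [hle]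
    le_inf := fun B B' B'' h₁ h₂ => by
      simp only [hle] at h₁ h₂ ⊢
      simpa using ⟨h₁, h₂⟩ }
  exact ⟨inferInstance, fun _ _ => Iff.rfl,
    { toEquiv := e, map_rel_iff' := fun {x y} => h.lo_le_iff }, fun _ => rfl⟩

end IsAtlasLattice

/-! ### The dissection as a modular connected system -/

theorem IsLFFC.of_orderIso {P Q : Type*} [PartialOrder P] [PartialOrder Q] (hP : IsLFFC P)
    (e : P ≃o Q) : IsLFFC Q where
  finite_Icc a b := (hP.finite_Icc (e.symm a) (e.symm b)).preimage
    e.symm.injective.injOn |>.subset fun _ hz => ⟨e.symm.monotone hz.1, e.symm.monotone hz.2⟩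
  finite_upper a := (hP.finite_upper (e.symm a)).preimage
    e.symm.injective.injOn |>.subset fun _ hz => (apply_covBy_apply_iff e.symm).2 hz
  finite_lower a := (hP.finite_lower (e.symm a)).preimage
    e.symm.injective.injOn |>.subset fun _ hz => (apply_covBy_apply_iff e.symm).2 hz

namespace IsAtlasLattice

variable {S : Type*} {P : Type u} [Lattice S] [Lattice P] {R : S → P → P → Prop} {lo hi : S → P}

/-- As all connections are identities, the axioms become statements about membership. Monotonicity
of minima and maxima gives the filters, ideals and axiom 4; closure of index sets under join and
meet gives axiom 5; maximality of blocks gives the inequalities of axiom 6. -/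
theorem dissection_isMCSystem [Lattice (Block P)] (h : IsAtlasLattice R lo hi)
    (hc : Complemented lo hi) (hS : IsLFFC S)
    (htol : IsTolerance fun x y => ∃ p, R x p p ∧ R y p p)
    (e : S ≃o Block P) (he : ∀ x, e x = h.block hc x) : (dissection P).IsMCSystem := by
  have mem : ∀ {x p}, p ∈ (e x).carrier ↔ R x p p := fun {x p} => by
    rw [he, h.mem_iff]
    rfl
  have zero_le : ∀ {B B' : Block P}, B ≤ B' → B.zero ≤ B'.zero := fun {B B'} hle => by
    obtain ⟨x, rfl⟩ := e.surjective B
    obtain ⟨y, rfl⟩ := e.surjective B'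
    rw [he, he]
    exact h.lo_le_iff.2 (e.le_iff_le.1 hle)
  have one_le : ∀ {B B' : Block P}, B ≤ B' → B.one ≤ B'.one := fun {B B'} hle => by
    obtain ⟨x, rfl⟩ := e.surjective B
    obtain ⟨y, rfl⟩ := e.surjective B'
    rw [he, he]
    exact h.hi_le_iff.2 (e.le_iff_le.1 hle)
  have meet_iff : ∀ {x y}, (dissection P).γ (e x) (e y) ↔ ∃ p, R x p p ∧ R y p p := fun {x y} =>
    exists_congr fun p => and_congr mem mem
  have hmod := h.isModularLattice
  have not_subset : ∀ {B B' : Block P}, B.carrier ⊆ B'.carrier → B = B' := fun {B B'} hle => by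
    have heq := hle.antisymm (B.maximal.2 B'.maximal.1 hle)
    exact Block.ext
      (le_antisymm (heq.ge ⟨le_rfl, B'.zero_le_one⟩).1 (hle ⟨le_rfl, B.zero_le_one⟩).1)
      (le_antisymm (hle ⟨B.zero_le_one, le_rfl⟩).2 (heq.ge ⟨B'.zero_le_one, le_rfl⟩).2)
  exact {
    tolerance := {
      refl := fun B => ⟨B.zero, ⟨le_rfl, B.zero_le_one⟩, le_rfl, B.zero_le_one⟩
      symm := fun B B' hγ => by
        obtain ⟨p, hp, hp'⟩ := hγ
        exact ⟨p, hp', hp⟩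
      sup := fun A B A' B' h₁ h₂ => by
        obtain ⟨x, rfl⟩ := e.surjective A
        obtain ⟨y, rfl⟩ := e.surjective B
        obtain ⟨x', rfl⟩ := e.surjective A'
        obtain ⟨y', rfl⟩ := e.surjective B'
        rw [← map_sup, ← map_sup, meet_iff]
        exact htol.sup _ _ _ _ (meet_iff.1 h₁) (meet_iff.1 h₂)
      inf := fun A B A' B' h₁ h₂ => by
        obtain ⟨x, rfl⟩ := e.surjective A
        obtain ⟨y, rfl⟩ := e.surjective B
        obtain ⟨x', rfl⟩ := e.surjective A'
        obtain ⟨y', rfl⟩ := e.surjective B'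
        rw [← map_inf, ← map_inf, meet_iff]
        exact htol.inf _ _ _ _ (meet_iff.1 h₁) (meet_iff.1 h₂) }
    skeleton_lffc := hS.of_orderIso e
    block_finite := fun B => (h.finite_Icc B.zero B.one).to_subtype
    block_modular := fun B =>
      ⟨fun {x} y {z} hxz => IsModularLattice.sup_inf_le_assoc_of_le (x := (x : P)) (y : P) hxz⟩
    block_complemented := fun B => ⟨fun c => by
      obtain ⟨x, rfl⟩ := e.surjective B
      obtain ⟨c, hcB⟩ := c
      obtain ⟨d, hd, hinf, hsup⟩ := hc x c (by rwa [he] at hcB)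
      refine ⟨⟨d, by rw [he]; exact hd⟩, ?_, ?_⟩
      · rw [disjoint_iff, Subtype.ext_iff]
        refine hinf.trans ?_
        change lo x = (e x).zero
        rw [he]
        rfl
      · rw [codisjoint_iff, Subtype.ext_iff]
        refine hsup.trans ?_
        change hi x = (e x).one
        rw [he]
        rfl⟩
    filter := fun B B' hle hγ => by
      obtain ⟨p, hp, hp'⟩ := hγ
      exact Order.IsPFilter.of_def ⟨⟨p, hp⟩, hp'⟩
        (fun a ha b hb => ⟨a ⊓ b, ⟨le_inf ha.1 hb.1, inf_le_left.trans ha.2⟩, inf_le_left,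
          inf_le_right⟩)
        fun {a b} hab ha => ⟨ha.1.trans hab, b.2.2.trans (one_le hle)⟩
    ideal := fun B B' hle hγ => by
      obtain ⟨p, hp, hp'⟩ := hγ
      exact ⟨fun a b hab ha => ⟨(zero_le hle).trans b.2.1, le_trans hab ha.2⟩, ⟨⟨p, hp'⟩, hp⟩,
        fun a ha b hb => ⟨a ⊔ b, ⟨ha.1.trans le_sup_left, sup_le ha.2 hb.2⟩, le_sup_left,
          le_sup_right⟩⟩
    iso := fun B B' hle hγ => ⟨{
      toFun := (dissection P).φ B B'
      invFun := fun b => ⟨⟨b, b.2⟩, b.1.2⟩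
      left_inv := fun _ => rfl
      right_inv := fun _ => rfl
      map_rel_iff' := Iff.rfl }, fun _ => rfl⟩
    F_self := fun B => Set.eq_univ_of_forall fun a => a.2
    I_self := fun B => Set.eq_univ_of_forall fun a => a.2
    φ_self := fun _ _ => rfl
    γ_of_nonempty := fun A B B' _ _ _ _ hne => by
      obtain ⟨p, hp, hp'⟩ := hne
      exact ⟨p, hp, hp'⟩
    F_comp := fun A B B' h₁ h₂ _ => by
      ext a
      constructor
      · intro ha
        have hB : (a : P) ∈ B.carrier := ⟨(zero_le h₂).trans ha.1, a.2.2.trans (one_le h₁)⟩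
        exact ⟨hB, a.2, ha⟩
      · rintro ⟨_, _, ha⟩
        exact ha
    I_comp := fun A B B' h₁ h₂ _ => by
      ext b
      constructor
      · intro hb
        have hB : (b : P) ∈ B.carrier := ⟨(zero_le h₂).trans b.2.1, hb.2.trans (one_le h₁)⟩
        exact ⟨⟨⟨b, hB⟩, b.2⟩, ⟨hb, b.2⟩, rfl⟩
      · rintro ⟨c, hc, rfl⟩
        exact hc.1
    φ_comp := fun _ _ _ _ _ _ _ _ _ _ => rfl
    I_inter := fun A B _ a ha => by
      obtain ⟨x, rfl⟩ := e.surjective A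
      obtain ⟨y, rfl⟩ := e.surjective B
      change (a : P) ∈ (e x ⊓ e y).carrier
      rw [← map_inf, mem]
      exact h.inf_mem (mem.1 ha.1) (mem.1 ha.2)
    F_inter := fun A B _ a ha => by
      obtain ⟨x, rfl⟩ := e.surjective A
      obtain ⟨y, rfl⟩ := e.surjective B
      change (a : P) ∈ (e x ⊔ e y).carrier
      rw [← map_sup, mem]
      exact h.sup_mem (mem.1 ha.1) (mem.1 ha.2)
    γ_of_covBy := fun A B hAB => by
      obtain ⟨x, rfl⟩ := e.surjective A
      obtain ⟨y, rfl⟩ := e.surjective B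
      exact meet_iff.2 (h.meet ((apply_covBy_apply_iff e).1 hAB))
    F_ne := fun A B hAB heq => hAB.lt.ne (not_subset fun a ha =>
      show (⟨a, ha⟩ : A.carrier) ∈ (dissection P).F A B from heq ▸ Set.mem_univ _)
    I_ne := fun A B hAB heq => hAB.lt.ne' (not_subset fun a ha =>
      show (⟨a, ha⟩ : B.carrier) ∈ (dissection P).I A B from heq ▸ Set.mem_univ _) }

end IsAtlasLattice

/-! ### Tolerances -/

theorem IsTolerance.sup_left {S : Type*} [Lattice S] {r : S → S → Prop} (hr : IsTolerance r)
    {x y : S} (hxy : r x y) : r x (x ⊔ y) := by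
  simpa using hr.sup x x x y (hr.refl x) hxy

theorem IsTolerance.inf_sup {S : Type*} [Lattice S] {r : S → S → Prop} (hr : IsTolerance r)
    {x y : S} (hxy : r x y) : r (x ⊓ y) (x ⊔ y) := by
  have h₁ := hr.sup_left hxy
  have h₂ := hr.sup_left (hr.symm _ _ hxy)
  rw [sup_comm] at h₂
  simpa using hr.inf _ _ _ _ h₁ h₂

theorem IsTolerance.mono {S : Type*} [Lattice S] {r : S → S → Prop} (hr : IsTolerance r)
    {x y z w : S} (h : r x w) (hxy : x ≤ y) (hyz : y ≤ z) (hzw : z ≤ w) : r y z := by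
  have h₁ := hr.sup x w y y h (hr.refl y)
  rw [sup_eq_right.2 hxy, sup_eq_left.2 (hyz.trans hzw)] at h₁
  have h₂ := hr.inf y w z z h₁ (hr.refl z)
  rwa [inf_eq_left.2 hyz, inf_eq_right.2 hzw] at h₂

theorem IsTolerance.of_le_le {S : Type*} [Lattice S] {r : S → S → Prop} (hr : IsTolerance r)
    {x y z : S} (hxz : r x z) (hyz : r y z) (hx : x ≤ z) (hy : y ≤ z) : r x y := by
  have := hr.inf x z z y hxz (hr.symm _ _ hyz)
  rwa [inf_eq_left.2 hx, inf_eq_right.2 hy] at this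

theorem IsTolerance.of_ge_ge {S : Type*} [Lattice S] {r : S → S → Prop} (hr : IsTolerance r)
    {x y z : S} (hxz : r z x) (hyz : r z y) (hx : z ≤ x) (hy : z ≤ y) : r x y := by
  have := hr.sup x z z y (hr.symm _ _ hxz) hyz
  rwa [sup_eq_left.2 hx, sup_eq_right.2 hy] at this

/-! ### Connections as partial maps, and the atlas of a sum -/

namespace Connections

variable {S : Type u} [Lattice S] {L : S → Type v}

/-- The connection from `x` to `y` is defined at `a`, with value `b`. -/
def Conn (C : Connections S L) (x y : S) (a : L x) (b : L y) : Prop :=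
  x ≤ y ∧ C.γ x y ∧ ∃ h : a ∈ C.F x y, (C.φ x y ⟨a, h⟩ : L y) = b

theorem exists_conn_of_mem_F (C : Connections S L) {x y : S} (hxy : x ≤ y) (hγ : C.γ x y) {a : L x}
    (ha : a ∈ C.F x y) : ∃ b, C.Conn x y a b :=
  ⟨_, hxy, hγ, ha, rfl⟩

theorem Conn.mem_I {C : Connections S L} {x y : S} {a : L x} {b : L y}
    (h : C.Conn x y a b) : b ∈ C.I x y := by
  obtain ⟨_, _, _, rfl⟩ := h
  exact Subtype.property _

theorem Conn.mem_F {C : Connections S L} {x y : S} {a : L x} {b : L y}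
    (h : C.Conn x y a b) : a ∈ C.F x y :=
  h.2.2.1

variable [∀ x, Lattice (L x)]

theorem leAt_self_iff {C : Connections S L} {x : S} {p : C.Sum} : C.LEAt x p p ↔ ∃ a, C.π x a = p :=
  ⟨fun ⟨a, _, h, _⟩ => ⟨a, h⟩, fun ⟨a, h⟩ => ⟨a, a, h, h, le_rfl⟩⟩

variable [∀ x, BoundedOrder (L x)]

namespace IsMCSystem

variable {C : Connections S L}

theorem conn_self_iff (hC : C.IsMCSystem) {x : S} {a b : L x} : C.Conn x x a b ↔ a = b := by
  refine ⟨fun ⟨_, _, h, hab⟩ => by rw [← hab, hC.φ_self], ?_⟩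
  rintro rfl
  exact ⟨le_rfl, hC.tolerance.refl x, by rw [hC.F_self]; trivial, hC.φ_self _ _⟩

theorem conn_le_iff (hC : C.IsMCSystem) {x y : S} {a a' : L x} {b b' : L y}
    (h : C.Conn x y a b) (h' : C.Conn x y a' b') : a ≤ a' ↔ b ≤ b' := by
  obtain ⟨hxy, hγ, ha, rfl⟩ := h
  obtain ⟨_, _, ha', rfl⟩ := h'
  obtain ⟨e, he⟩ := hC.iso x y hxy hγ
  rw [← he, ← he]
  exact (e.le_iff_le (x := ⟨a, ha⟩) (y := ⟨a', ha'⟩)).symm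

theorem conn_left_unique (hC : C.IsMCSystem) {x y : S} {a a' : L x} {b : L y}
    (h : C.Conn x y a b) (h' : C.Conn x y a' b) : a = a' :=
  le_antisymm ((hC.conn_le_iff h h').2 le_rfl) ((hC.conn_le_iff h' h).2 le_rfl)

theorem conn_right_unique (hC : C.IsMCSystem) {x y : S} {a : L x} {b b' : L y}
    (h : C.Conn x y a b) (h' : C.Conn x y a b') : b = b' :=
  le_antisymm ((hC.conn_le_iff h h').1 le_rfl) ((hC.conn_le_iff h' h).1 le_rfl)

theorem exists_conn_of_mem_I (hC : C.IsMCSystem) {x y : S} (hxy : x ≤ y) (hγ : C.γ x y) {b : L y}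
    (hb : b ∈ C.I x y) : ∃ a, C.Conn x y a b := by
  obtain ⟨e, he⟩ := hC.iso x y hxy hγ
  exact ⟨e.symm ⟨b, hb⟩, hxy, hγ, (e.symm ⟨b, hb⟩).2, by rw [Subtype.coe_eta, ← he]; simp⟩

theorem conn_interpolate (hC : C.IsMCSystem) {x y z : S} {a : L x} {c : L z}
    (h : C.Conn x z a c) (hxy : x ≤ y) (hyz : y ≤ z) : ∃ b, C.Conn x y a b ∧ C.Conn y z b c := by
  obtain ⟨hxz, hγ, ha, rfl⟩ := h
  obtain ⟨h₁, h₂⟩ := (hC.F_comp x y z hxy hyz hγ).le ha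
  exact ⟨_, ⟨hxy, hC.tolerance.mono hγ le_rfl hxy hyz, h₁, rfl⟩,
    ⟨hyz, hC.tolerance.mono hγ hxy hyz le_rfl, h₂.2, (hC.φ_comp x y z hxy hyz hγ a ha h₁ h₂.2).symm⟩⟩

theorem conn_trans (hC : C.IsMCSystem) {x y z : S} {a : L x} {b : L y} {c : L z}
    (h : C.Conn x y a b) (h' : C.Conn y z b c) : C.Conn x z a c := by
  have hb := h.mem_I
  obtain ⟨hxy, hγ, ha, rfl⟩ := h
  obtain ⟨hyz, hγ', hb', rfl⟩ := h'
  have hγ'' := hC.γ_of_nonempty x y z hxy hγ hyz hγ' ⟨_, hb, hb'⟩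
  have ha' : a ∈ C.F x z := (hC.F_comp x y z hxy hyz hγ'').ge ⟨ha, hb, hb'⟩
  exact ⟨hxy.trans hyz, hγ'', ha', hC.φ_comp x y z hxy hyz hγ'' a ha' ha hb'⟩

/-- Both elements already agree in block `x ⊔ y`, by interpolation. Their common image there lies in
both ideals, so axiom 5 provides a preimage in block `x ⊓ y`. -/
theorem conn_amalgam_down (hC : C.IsMCSystem) {x y z : S} {a : L x} {b : L y} {c : L z}
    (h : C.Conn x z a c) (h' : C.Conn y z b c) :
    ∃ d, C.Conn (x ⊓ y) x d a ∧ C.Conn (x ⊓ y) y d b := by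
  obtain ⟨s, has, hsc⟩ := hC.conn_interpolate h le_sup_left (sup_le h.1 h'.1)
  obtain ⟨s', hbs, hsc'⟩ := hC.conn_interpolate h' le_sup_right (sup_le h.1 h'.1)
  obtain rfl := hC.conn_left_unique hsc hsc'
  have hγ := hC.tolerance.of_le_le h.2.1 h'.2.1 h.1 h'.1
  obtain ⟨d, hd⟩ := hC.exists_conn_of_mem_I (inf_le_left.trans le_sup_left)
    (hC.tolerance.inf_sup hγ) (hC.I_inter x y hγ ⟨has.mem_I, hbs.mem_I⟩)
  obtain ⟨a', hda, has'⟩ := hC.conn_interpolate hd inf_le_left le_sup_left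
  obtain ⟨b', hdb, hbs'⟩ := hC.conn_interpolate hd inf_le_right le_sup_right
  exact ⟨d, hC.conn_left_unique has has' ▸ hda, hC.conn_left_unique hbs hbs' ▸ hdb⟩

theorem conn_amalgam_up (hC : C.IsMCSystem) {x y z : S} {a : L x} {b : L y} {c : L z}
    (h : C.Conn z x c a) (h' : C.Conn z y c b) :
    ∃ d, C.Conn x (x ⊔ y) a d ∧ C.Conn y (x ⊔ y) b d := by
  obtain ⟨s, hcs, hsa⟩ := hC.conn_interpolate h (le_inf h.1 h'.1) inf_le_left
  obtain ⟨s', hcs', hsb⟩ := hC.conn_interpolate h' (le_inf h.1 h'.1) inf_le_right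
  obtain rfl := hC.conn_right_unique hcs hcs'
  have hγ := hC.tolerance.of_ge_ge h.2.1 h'.2.1 h.1 h'.1
  obtain ⟨d, hd⟩ := exists_conn_of_mem_F C (inf_le_left.trans le_sup_left)
    (hC.tolerance.inf_sup hγ) (hC.F_inter x y hγ ⟨hsa.mem_F, hsb.mem_F⟩)
  obtain ⟨a', hda, had⟩ := hC.conn_interpolate hd inf_le_left le_sup_left
  obtain ⟨b', hdb, hbd⟩ := hC.conn_interpolate hd inf_le_right le_sup_right
  exact ⟨d, hC.conn_right_unique hda hsa ▸ had, hC.conn_right_unique hdb hsb ▸ hbd⟩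

theorem sim_iff_sup (hC : C.IsMCSystem) {p q : Σ x, L x} : C.Sim p q ↔
    ∃ c, C.Conn p.1 (p.1 ⊔ q.1) p.2 c ∧ C.Conn q.1 (p.1 ⊔ q.1) q.2 c := by
  constructor
  · rintro ⟨hγ, hp, hq, heq⟩
    have hγ' := hC.tolerance.sup_left (hC.tolerance.symm _ _ hγ)
    rw [sup_comm] at hγ'
    exact ⟨_, ⟨le_sup_left, hC.tolerance.sup_left hγ, hp, rfl⟩, ⟨le_sup_right, hγ', hq, heq.symm⟩⟩
  · rintro ⟨c, ⟨hp, hpγ, hpF, hpc⟩, ⟨hq, hqγ, hqF, hqc⟩⟩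
    exact ⟨hC.tolerance.of_le_le hpγ hqγ hp hq, hpF, hqF, hpc.trans hqc.symm⟩

/-- Any common upper block may replace `x ⊔ y`: amalgamate down to the meet, then up to the join. In
this form transitivity of `∼` is one amalgamation followed by composition. -/
theorem sim_iff_up (hC : C.IsMCSystem) {p q : Σ x, L x} : C.Sim p q ↔
    ∃ z c, C.Conn p.1 z p.2 c ∧ C.Conn q.1 z q.2 c := by
  refine ⟨fun h => ⟨_, hC.sim_iff_sup.1 h⟩, fun ⟨z, c, h, h'⟩ => ?_⟩
  obtain ⟨d, hd, hd'⟩ := hC.conn_amalgam_down h h'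
  exact hC.sim_iff_sup.2 (hC.conn_amalgam_up hd hd')

theorem sim_equivalence (hC : C.IsMCSystem) : Equivalence C.Sim where
  refl p := hC.sim_iff_up.2 ⟨p.1, p.2, hC.conn_self_iff.2 rfl, hC.conn_self_iff.2 rfl⟩
  symm h := by
    obtain ⟨z, c, h, h'⟩ := hC.sim_iff_up.1 h
    exact hC.sim_iff_up.2 ⟨z, c, h', h⟩
  trans h₁ h₂ := by
    obtain ⟨z, c, hpc, hqc⟩ := hC.sim_iff_up.1 h₁
    obtain ⟨w, d, hqd, hrd⟩ := hC.sim_iff_up.1 h₂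
    obtain ⟨e, hce, hde⟩ := hC.conn_amalgam_up hqc hqd
    exact hC.sim_iff_up.2 ⟨_, e, hC.conn_trans hpc hce, hC.conn_trans hrd hde⟩

theorem π_eq_iff_sim (hC : C.IsMCSystem) {x y : S} {a : L x} {b : L y} :
    C.π x a = C.π y b ↔ C.Sim ⟨x, a⟩ ⟨y, b⟩ :=
  ⟨fun h => Quotient.exact (s := ⟨C.Sim, hC.sim_equivalence⟩) h, fun h => Quot.sound h⟩

theorem π_eq_iff_of_le (hC : C.IsMCSystem) {x y : S} (hxy : x ≤ y) {a : L x} {b : L y} :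
    C.π x a = C.π y b ↔ C.Conn x y a b := by
  rw [hC.π_eq_iff_sim, hC.sim_iff_up]
  refine ⟨fun ⟨z, c, h, h'⟩ => ?_, fun h => ⟨y, b, h, hC.conn_self_iff.2 rfl⟩⟩
  obtain ⟨b', hb, hb'⟩ := hC.conn_interpolate h hxy h'.1
  obtain rfl : b' = b := hC.conn_left_unique hb' h'
  exact hb

theorem π_injective (hC : C.IsMCSystem) (x : S) : Function.Injective (C.π x) := fun _ _ h =>
  hC.conn_self_iff.1 ((hC.π_eq_iff_of_le le_rfl).1 h)

theorem leAt_π_iff (hC : C.IsMCSystem) {x : S} {a b : L x} :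
    C.LEAt x (C.π x a) (C.π x b) ↔ a ≤ b := by
  refine ⟨fun ⟨a', b', ha, hb, hab⟩ => ?_, fun h => ⟨a, b, rfl, rfl, h⟩⟩
  rwa [← hC.π_injective x ha, ← hC.π_injective x hb]

theorem exists_leAt_self_of_γ (hC : C.IsMCSystem) {x y : S} (hγ : C.γ x y) :
    ∃ p, C.LEAt x p p ∧ C.LEAt y p p := by
  have hγx := hC.tolerance.sup_left hγ
  have hγy := hC.tolerance.sup_left (hC.tolerance.symm _ _ hγ)
  rw [sup_comm] at hγy
  have hx := hC.ideal _ _ le_sup_left hγx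
  have hy := hC.ideal _ _ le_sup_right hγy
  obtain ⟨i, hi⟩ := hx.Nonempty
  obtain ⟨j, hj⟩ := hy.Nonempty
  obtain ⟨a, ha⟩ := hC.exists_conn_of_mem_I le_sup_left hγx (hx.IsLowerSet bot_le hi)
  obtain ⟨b, hb⟩ := hC.exists_conn_of_mem_I le_sup_right hγy (hy.IsLowerSet bot_le hj)
  -- The bottom of block `x ⊔ y` lies in every nonempty ideal of it, so it is a common point of
  -- blocks `x` and `y`.
  exact ⟨C.π (x ⊔ y) ⊥, leAt_self_iff.2 ⟨a, (hC.π_eq_iff_of_le le_sup_left).2 ha⟩,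
    leAt_self_iff.2 ⟨b, (hC.π_eq_iff_of_le le_sup_right).2 hb⟩⟩

theorem γ_iff_exists_leAt_self (hC : C.IsMCSystem) {x y : S} :
    C.γ x y ↔ ∃ p, C.LEAt x p p ∧ C.LEAt y p p := by
  refine ⟨hC.exists_leAt_self_of_γ, fun ⟨p, hx, hy⟩ => ?_⟩
  obtain ⟨a, rfl⟩ := leAt_self_iff.1 hx
  obtain ⟨b, hb⟩ := leAt_self_iff.1 hy
  exact (hC.π_eq_iff_sim.1 hb.symm).1

theorem isAtlas (hC : C.IsMCSystem) : IsAtlas C.LEAt where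
  left := fun ⟨a, _, ha, _⟩ => leAt_self_iff.2 ⟨a, ha⟩
  right := fun ⟨_, b, _, hb, _⟩ => leAt_self_iff.2 ⟨b, hb⟩
  trans := by
    rintro x _ _ _ ⟨a, b, rfl, rfl, hab⟩ ⟨b', c, hb, rfl, hbc⟩
    obtain rfl := hC.π_injective x hb
    exact hC.leAt_π_iff.2 (hab.trans hbc)
  antisymm := by
    rintro x _ _ ⟨a, b, rfl, rfl, hab⟩ h
    rw [hab.antisymm (hC.leAt_π_iff.1 h)]
  sup := by
    rintro x p q hp hq
    obtain ⟨a, rfl⟩ := leAt_self_iff.1 hp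
    obtain ⟨b, rfl⟩ := leAt_self_iff.1 hq
    refine ⟨C.π x (a ⊔ b), hC.leAt_π_iff.2 le_sup_left, hC.leAt_π_iff.2 le_sup_right, ?_⟩
    rintro _ ⟨a', t, ha, rfl, hat⟩ hbt
    obtain rfl := hC.π_injective x ha
    exact hC.leAt_π_iff.2 (sup_le hat (hC.leAt_π_iff.1 hbt))
  inf := by
    rintro x p q hp hq
    obtain ⟨a, rfl⟩ := leAt_self_iff.1 hp
    obtain ⟨b, rfl⟩ := leAt_self_iff.1 hq
    refine ⟨C.π x (a ⊓ b), hC.leAt_π_iff.2 inf_le_left, hC.leAt_π_iff.2 inf_le_right, ?_⟩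
    rintro _ ⟨t, a', rfl, ha, hat⟩ hbt
    obtain rfl := hC.π_injective x ha
    exact hC.leAt_π_iff.2 (le_inf hat (hC.leAt_π_iff.1 hbt))
  bot x := ⟨C.π x ⊥, hC.leAt_π_iff.2 le_rfl, fun p hp => by
    obtain ⟨a, rfl⟩ := leAt_self_iff.1 hp
    exact hC.leAt_π_iff.2 bot_le⟩
  top x := ⟨C.π x ⊤, hC.leAt_π_iff.2 le_rfl, fun p hp => by
    obtain ⟨a, rfl⟩ := leAt_self_iff.1 hp
    exact hC.leAt_π_iff.2 le_top⟩
  cover p := by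
    obtain ⟨⟨x, a⟩, rfl⟩ := Quot.exists_rep p
    exact ⟨x, hC.leAt_π_iff.2 le_rfl⟩
  sup_mem := by
    intro x y p hx hy
    obtain ⟨a, rfl⟩ := leAt_self_iff.1 hx
    obtain ⟨b, hb⟩ := leAt_self_iff.1 hy
    obtain ⟨c, hc, -⟩ := hC.sim_iff_sup.1 (hC.π_eq_iff_sim.1 hb.symm)
    exact leAt_self_iff.2 ⟨c, ((hC.π_eq_iff_of_le le_sup_left).2 hc).symm⟩
  inf_mem := by
    intro x y p hx hy
    obtain ⟨a, rfl⟩ := leAt_self_iff.1 hx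
    obtain ⟨b, hb⟩ := leAt_self_iff.1 hy
    obtain ⟨c, hc, hc'⟩ := hC.sim_iff_sup.1 (hC.π_eq_iff_sim.1 hb.symm)
    obtain ⟨d, hd, -⟩ := hC.conn_amalgam_down hc hc'
    exact leAt_self_iff.2 ⟨d, (hC.π_eq_iff_of_le inf_le_left).2 hd⟩
  convex := by
    intro x y z p hxy hyz hx hz
    obtain ⟨a, rfl⟩ := leAt_self_iff.1 hx
    obtain ⟨c, hc⟩ := leAt_self_iff.1 hz
    obtain ⟨b, hb, -⟩ := hC.conn_interpolate ((hC.π_eq_iff_of_le (hxy.trans hyz)).1 hc.symm) hxy hyz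
    exact leAt_self_iff.2 ⟨b, ((hC.π_eq_iff_of_le hxy).2 hb).symm⟩
  up := by
    rintro x y _ _ hxy hy ⟨a, a', rfl, rfl, hle⟩
    obtain ⟨b, hb⟩ := leAt_self_iff.1 hy
    have hab := (hC.π_eq_iff_of_le hxy).1 hb.symm
    obtain ⟨b', hab'⟩ := exists_conn_of_mem_F C (a := a') hxy hab.2.1
      ((hC.filter x y hxy hab.2.1).IsLowerSet (OrderDual.toDual_le_toDual.2 hle) hab.mem_F)
    rw [← hb, (hC.π_eq_iff_of_le hxy).2 hab', hC.leAt_π_iff, ← hC.conn_le_iff hab hab']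
    exact hle
  down := by
    rintro x y _ _ hxy hx ⟨b, b', rfl, rfl, hle⟩
    obtain ⟨a', ha⟩ := leAt_self_iff.1 hx
    have hab' := (hC.π_eq_iff_of_le hxy).1 ha
    obtain ⟨a, hab⟩ := hC.exists_conn_of_mem_I hxy hab'.2.1
      ((hC.ideal x y hxy hab'.2.1).IsLowerSet hle hab'.mem_I)
    rw [← ha, ← (hC.π_eq_iff_of_le hxy).2 hab, hC.leAt_π_iff, hC.conn_le_iff hab hab']
    exact hle
  meet hxy := hC.exists_leAt_self_of_γ (hC.γ_of_covBy _ _ hxy)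

/-- `AtlasLE` puts no condition on the indices of a chain, while `SumLE` wants them increasing.
Replacing each index by its join with the previous new index makes up the difference. -/
theorem sumLE_iff_atlasLE (hC : C.IsMCSystem) {p q : C.Sum} :
    C.SumLE p q ↔ AtlasLE C.LEAt p q := by
  constructor
  · rintro ⟨n, x, a, -, hle, rfl, rfl⟩
    have key : ∀ i : Fin (n + 1), AtlasLE C.LEAt (a 0) (a i) := by
      intro i
      induction i using Fin.induction with
      | zero => exact .refl
      | succ i ih => exact ih.tail ⟨x i, hle i⟩
    exact key _
  -- The lower bound `y` on all indices is carried along so that a new first index can be prepended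
  -- monotonically.
  · have key : AtlasLE C.LEAt p q → ∀ y, C.LEAt y p p → ∃ (n : ℕ) (x : Fin n → S)
        (a : Fin (n + 1) → C.Sum), Monotone x ∧ (∀ i, y ≤ x i) ∧
        (∀ i : Fin n, C.LEAt (x i) (a i.castSucc) (a i.succ)) ∧ a 0 = p ∧ a (Fin.last n) = q := by
      intro h
      induction h using Relation.ReflTransGen.head_induction_on with
      | refl => exact fun y _ => ⟨0, Fin.elim0, fun _ => q, fun i => i.elim0, fun i => i.elim0,
          fun i => i.elim0, rfl, rfl⟩
      | @head p r hpr _ ih =>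
        intro y hy
        obtain ⟨w, hw⟩ := hpr
        have hpr := hC.isAtlas.up le_sup_right
          (hC.isAtlas.sup_mem hy (hC.isAtlas.left hw)) hw
        obtain ⟨n, x, a, hmono, hge, hle, h0, hlast⟩ := ih _ (hC.isAtlas.right hpr)
        refine ⟨n + 1, Fin.cons (y ⊔ w) x, Fin.cons p a, ?_, ?_, ?_, rfl, ?_⟩
        · intro i j hij
          induction i using Fin.cases with
          | zero =>
            induction j using Fin.cases with
            | zero => exact le_rfl
            | succ j => exact hge j
          | succ i =>
            induction j using Fin.cases with
            | zero => exact absurd hij (by simp)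
            | succ j => exact hmono (Fin.succ_le_succ_iff.1 hij)
        · intro i
          induction i using Fin.cases with
          | zero => exact le_sup_left
          | succ i => exact le_sup_left.trans (hge i)
        · intro i
          induction i using Fin.cases with
          | zero =>
            change C.LEAt (y ⊔ w) p (a 0)
            rwa [h0]
          | succ i => exact hle i
        · exact hlast
    intro h
    obtain ⟨y, hy⟩ := hC.isAtlas.cover p
    obtain ⟨n, x, a, hmono, -, hle⟩ := key h y hy
    exact ⟨n, x, a, hmono, hle⟩

end IsMCSystem

end Connections

/-! ### The lattice structure of the sum and the isomorphism -/

namespace Connections.IsMCSystem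

variable {S : Type u} [Lattice S] {L : S → Type v} [∀ x, Lattice (L x)] [∀ x, BoundedOrder (L x)]
  {C : Connections S L}

theorem I_eq_univ_of_top_mem (hC : C.IsMCSystem) {x y : S} (hxy : x ≤ y) (hγ : C.γ x y)
    (h : ⊤ ∈ C.I x y) : C.I x y = Set.univ :=
  Set.eq_univ_of_forall fun _ => (hC.ideal x y hxy hγ).IsLowerSet le_top h

theorem F_eq_univ_of_bot_mem (hC : C.IsMCSystem) {x y : S} (hxy : x ≤ y) (hγ : C.γ x y)
    (h : ⊥ ∈ C.F x y) : C.F x y = Set.univ :=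
  Set.eq_univ_of_forall fun a => (hC.filter x y hxy hγ).IsLowerSet
    (OrderDual.toDual_le_toDual.2 (bot_le (a := a))) h

theorem isTolerance_meet (hC : C.IsMCSystem) :
    IsTolerance fun x y => ∃ p, C.LEAt x p p ∧ C.LEAt y p p := by
  simpa only [← hC.γ_iff_exists_leAt_self] using hC.tolerance

section

variable [Lattice C.Sum]

theorem π_le_iff (hC : C.IsMCSystem) (hle : ∀ p q : C.Sum, p ≤ q ↔ AtlasLE C.LEAt p q) {x : S}
    {a b : L x} : C.π x a ≤ C.π x b ↔ a ≤ b := by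
  rw [hle, ← hC.leAt_π_iff]
  exact ⟨fun h => hC.isAtlas.inside h (hC.leAt_π_iff.2 le_rfl) (hC.leAt_π_iff.2 le_rfl), .of x⟩

theorem exists_π_eq (hC : C.IsMCSystem) (hle : ∀ p q : C.Sum, p ≤ q ↔ AtlasLE C.LEAt p q) {x : S}
    {a b : L x} {p : C.Sum} (h₁ : C.π x a ≤ p) (h₂ : p ≤ C.π x b) : ∃ c, C.π x c = p :=
  leAt_self_iff.1 (hC.isAtlas.between ((hle _ _).1 h₁) ((hle _ _).1 h₂) (hC.leAt_π_iff.2 le_rfl)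
    (hC.leAt_π_iff.2 le_rfl))

theorem π_sup (hC : C.IsMCSystem) (hle : ∀ p q : C.Sum, p ≤ q ↔ AtlasLE C.LEAt p q) (x : S)
    (a b : L x) : C.π x (a ⊔ b) = C.π x a ⊔ C.π x b := by
  have h : C.π x a ⊔ C.π x b ≤ C.π x (a ⊔ b) :=
    sup_le ((hC.π_le_iff hle).2 le_sup_left) ((hC.π_le_iff hle).2 le_sup_right)
  refine le_antisymm ?_ h
  -- The join taken in the sum lies between two points of the block, so by convexity it belongs to
  -- the block and can be compared with `a ⊔ b` there.
  obtain ⟨c, hc⟩ := hC.exists_π_eq hle le_sup_left h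
  rw [← hc, hC.π_le_iff hle]
  exact sup_le ((hC.π_le_iff hle).1 (hc ▸ le_sup_left)) ((hC.π_le_iff hle).1 (hc ▸ le_sup_right))

theorem π_inf (hC : C.IsMCSystem) (hle : ∀ p q : C.Sum, p ≤ q ↔ AtlasLE C.LEAt p q) (x : S)
    (a b : L x) : C.π x (a ⊓ b) = C.π x a ⊓ C.π x b := by
  have h : C.π x (a ⊓ b) ≤ C.π x a ⊓ C.π x b :=
    le_inf ((hC.π_le_iff hle).2 inf_le_left) ((hC.π_le_iff hle).2 inf_le_right)
  refine le_antisymm h ?_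
  obtain ⟨c, hc⟩ := hC.exists_π_eq hle h inf_le_left
  rw [← hc, hC.π_le_iff hle]
  exact le_inf ((hC.π_le_iff hle).1 (hc ▸ inf_le_left)) ((hC.π_le_iff hle).1 (hc ▸ inf_le_right))

theorem isAtlasLattice (hC : C.IsMCSystem) (hle : ∀ p q : C.Sum, p ≤ q ↔ AtlasLE C.LEAt p q) :
    IsAtlasLattice C.LEAt (fun x => C.π x ⊥) (fun x => C.π x ⊤) where
  toIsAtlas := hC.isAtlas
  le_iff := hle
  lo_mem _ := hC.leAt_π_iff.2 le_rfl
  hi_mem _ := hC.leAt_π_iff.2 le_rfl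
  lo_le hp := by
    obtain ⟨a, rfl⟩ := leAt_self_iff.1 hp
    exact hC.leAt_π_iff.2 bot_le
  le_hi hp := by
    obtain ⟨a, rfl⟩ := leAt_self_iff.1 hp
    exact hC.leAt_π_iff.2 le_top
  lo_ne {x y} hxy h := hC.F_ne x y hxy (hC.F_eq_univ_of_bot_mem hxy.le (hC.γ_of_covBy x y hxy)
    ((hC.π_eq_iff_of_le hxy.le).1 h).mem_F)
  hi_ne {x y} hxy h := hC.I_ne x y hxy (hC.I_eq_univ_of_top_mem hxy.le (hC.γ_of_covBy x y hxy)
    ((hC.π_eq_iff_of_le hxy.le).1 h).mem_I)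
  skeleton_finite := hC.skeleton_lffc.finite_Icc
  block_finite x := by
    have := hC.block_finite x
    exact (Set.finite_range (C.π x)).subset fun p hp => leAt_self_iff.1 hp
  block_modular {x _ _ _} ha hb hc hac := by
    obtain ⟨a, rfl⟩ := leAt_self_iff.1 ha
    obtain ⟨b, rfl⟩ := leAt_self_iff.1 hb
    obtain ⟨c, rfl⟩ := leAt_self_iff.1 hc
    have := hC.block_modular x
    rw [← hC.π_sup hle, ← hC.π_inf hle, ← hC.π_inf hle, ← hC.π_sup hle, hC.π_le_iff hle]
    exact IsModularLattice.sup_inf_le_assoc_of_le b ((hC.π_le_iff hle).1 hac)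

theorem range_π (hC : C.IsMCSystem) (hle : ∀ p q : C.Sum, p ≤ q ↔ AtlasLE C.LEAt p q) (x : S) :
    Set.range (C.π x) = Set.Icc (C.π x ⊥) (C.π x ⊤) := by
  ext p
  rw [← (hC.isAtlasLattice hle).mem_iff, leAt_self_iff, Set.mem_range]

theorem complemented (hC : C.IsMCSystem) (hle : ∀ p q : C.Sum, p ≤ q ↔ AtlasLE C.LEAt p q) :
    IsAtlasLattice.Complemented (fun x => C.π x ⊥) (fun x => C.π x ⊤) := by
  intro x
  simp only [← hC.range_π hle]
  rintro _ ⟨c, rfl⟩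
  have := hC.block_complemented x
  obtain ⟨d, hd⟩ := exists_isCompl c
  exact ⟨_, ⟨d, rfl⟩, by rw [← hC.π_inf hle, hd.inf_eq_bot], by rw [← hC.π_sup hle, hd.sup_eq_top]⟩

/-- The block `L x` as an interval of the sum. -/
noncomputable def blockIso (hC : C.IsMCSystem)
    (hle : ∀ p q : C.Sum, p ≤ q ↔ AtlasLE C.LEAt p q) (x : S) {B : Block C.Sum}
    (hB : B.carrier = Set.range (C.π x)) : L x ≃o B.carrier where
  toEquiv := (Equiv.ofInjective _ (hC.π_injective x)).trans (Equiv.setCongr hB.symm)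
  map_rel_iff' := hC.π_le_iff hle

/-- The isomorphism from a modular connected system to the dissection of its sum. -/
noncomputable def isoDissection [Lattice (Block C.Sum)] (hC : C.IsMCSystem)
    (hle : ∀ p q : C.Sum, p ≤ q ↔ AtlasLE C.LEAt p q) (e : S ≃o Block C.Sum)
    (he : ∀ x, (e x).carrier = Set.range (C.π x)) : C.Iso (dissection C.Sum) where
  skel := e
  block x := hC.blockIso hle x (he x)
  γ_iff x y := by
    rw [hC.γ_iff_exists_leAt_self]
    refine exists_congr fun p => ?_
    rw [Set.mem_inter_iff, he, he, leAt_self_iff, leAt_self_iff]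
    rfl
  map_F x y hxy hγ := by
    ext p
    obtain ⟨a, rfl⟩ := (hC.blockIso hle x (he x)).surjective p
    rw [(hC.blockIso hle x (he x)).injective.mem_set_image]
    change C.π x a ∈ (e y).carrier ↔ _
    rw [he]
    constructor
    · rintro ⟨b, hb⟩
      exact ((hC.π_eq_iff_of_le hxy).1 hb.symm).mem_F
    · intro ha
      obtain ⟨b, hb⟩ := exists_conn_of_mem_F C hxy hγ ha
      exact ⟨b, ((hC.π_eq_iff_of_le hxy).2 hb).symm⟩
  map_I x y hxy hγ := by
    ext p
    obtain ⟨b, rfl⟩ := (hC.blockIso hle y (he y)).surjective p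
    rw [(hC.blockIso hle y (he y)).injective.mem_set_image]
    change C.π y b ∈ (e x).carrier ↔ _
    rw [he]
    constructor
    · rintro ⟨a, ha⟩
      exact ((hC.π_eq_iff_of_le hxy).1 ha).mem_I
    · intro hb
      obtain ⟨a, ha⟩ := hC.exists_conn_of_mem_I hxy hγ hb
      exact ⟨a, (hC.π_eq_iff_of_le hxy).2 ha⟩
  comm x y hxy hγ a h h' := by
    apply Subtype.ext
    exact ((hC.π_eq_iff_of_le hxy).2 ⟨hxy, hγ, h, rfl⟩).symm

end

end Connections.IsMCSystem

end ModularGluing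

/-- The sum of a modular connected system is a modular lattice, locally finite with finite covers;
its blocks, ordered by their minimum elements, form a lattice; its dissection is a modular connected
system, and the maps `x ↦ Λ_x = [0_x, 1_x]` and `π_x` are an isomorphism onto it. The two lattice
structures in the statement are determined by the orders that are prescribed for them. -/
theorem mainTheorem7 {S : Type u} [Lattice S] {L : S → Type v} [∀ x, Lattice (L x)]
    [∀ x, BoundedOrder (L x)] (C : ModularGluing.Connections S L) (hC : C.IsMCSystem) :
    Equivalence C.Sim ∧
    ∃ _ : Lattice C.Sum, (∀ p q : C.Sum, p ≤ q ↔ C.SumLE p q) ∧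
      IsModularLattice C.Sum ∧ ModularGluing.IsLFFC C.Sum ∧
      ∃ _ : Lattice (ModularGluing.Block C.Sum),
        (∀ B B' : ModularGluing.Block C.Sum, B ≤ B' ↔ B.zero ≤ B'.zero) ∧
        (ModularGluing.dissection C.Sum).IsMCSystem ∧
        ∃ χ : ModularGluing.Connections.Iso C (ModularGluing.dissection C.Sum),
          (∀ x, (χ.skel x).carrier = Set.range (C.π x) ∧
            (χ.skel x).carrier = Set.Icc (C.π x ⊥) (C.π x ⊤)) ∧
          ∀ (x : S) (a : L x), (χ.block x a : C.Sum) = C.π x a := by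
  obtain ⟨_, hle⟩ := hC.isAtlas.exists_lattice hC.skeleton_lffc.finite_Icc
  have hA := hC.isAtlasLattice hle
  have hc := hC.complemented hle
  obtain ⟨_, hblock, e, he⟩ := hA.exists_block_lattice hc
  have he' : ∀ x, (e x).carrier = Set.range (C.π x) := fun x => by
    rw [he, hC.range_π hle]
    rfl
  exact ⟨hC.sim_equivalence, inferInstance, fun p q => (hle p q).trans hC.sumLE_iff_atlasLE.symm,
    hA.isModularLattice, hA.isLFFC, inferInstance, hblock,
    hA.dissection_isMCSystem hc hC.skeleton_lffc hC.isTolerance_meet e he,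
    hC.isoDissection hle e he', fun x => ⟨he' x, (he' x).trans (hC.range_π hle x)⟩, fun _ _ => rfl⟩
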